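/- Let $d\ge 1$ and let $P\subset\mathbb{R}^{d-1}\subset\mathbb{P}(\mathbb{R}^d)$ (affine chart $x\mapsto[x:1]$) be a convex polytope, i.e. the convex hull of finitely many points, with nonempty interior $\Omega$. Endow $\Omega$ with its Hilbert distance $$d_\Omega(x,y)=\sup_{\varphi,\psi}\ \log\left|\frac{\psi(x,1)}{\psi(y,1)}\cdot\frac{\varphi(y,1)}{\varphi(x,1)}\right|,$$ where $\varphi,\psi$ range over the linear forms on $\mathbb{R}^d$ with no zero on $\{(z,1): z\in\Omega\}$. Let $\omega$ be a non-principal ultrafilter on $\mathbb{N}$, let $(\lambda_n)_{n\in\mathbb N}$ be a sequence of real numbers with $\lambda_n\ge 1$ and $\lambda_n\to\infty$, and let $x_0\in\Omega$. The asymptotic cone $(X_\omega,d_\omega,o_\omega)$ of $(\Omega,d_\Omega)$ for these data is the set of sequences $(x_n)$ in $\Omega$ with $\lim_\omega \frac1{\lambda_n}d_\Omega(x_0,x_n)<\infty$, modulo $d_\omega=0$, where $d_\omega((x_n),(y_n))=\lim_\omega\frac1{\lambda_n}d_\Omega(x_n,y_n)$, and $o_\omega$ is the class of the constant sequence $x_0$.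 Let $\mathbb{A}=\mathbb{R}^d/\mathbb{R}(1,\dots,1)$ with the metric $d_{\mathrm H}$ induced by the norm $\|[\alpha]\|=\max_{i,j}|\alpha_i-\alpha_j|$, and for $D\subseteq\{1,\dots,d-1\}$ let $\mathbb{A}^+_D=\{[\alpha]\in\mathbb{A} : \alpha_1\ge\dots\ge\alpha_d,\ \alpha_i=\alpha_{i+1}\text{ for } i\notin D\}$. Let $\mathrm{Flags}_*(P)$ be the set of flags of nonempty faces of $P$ containing $P$ itself and, for such a flag $F$, let $D(F)=\{\dim\sigma+1 : \sigma\in F,\ \sigma\ne P\}$. Let $$K=K(P,\mathbb{R})=\Big(\bigsqcup_{F\in\mathrm{Flags}_*(P)}\mathbb{A}^+_{D(F)}\times\{F\}\Big)\Big/\!\sim,$$ where $\sim$ is the equivalence relation generated by $(x,F)\sim(x,F')$ for $F\subseteq F'$. Endow $K$ with the quotient (pseudo-)metric: the distance between two classes is the infimum of the lengths $\sum_k d(x_k,y_k)$ over chains $(x_1,y_1,\dots,x_m,y_m)$ in the disjoint union with $x_1$ in the first class, $y_m$ in the second and $y_k\sim x_{k+1}$, where $d$ is $d_{\mathrm H}$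 within each piece and $\infty$ between different pieces. Let $o\in K$ be the common class of the points $(0,F)$. Then $(X_\omega,d_\omega,o_\omega)$ is isometric to $K$ as a pointed space: there is a bijective isometry $X_\omega\to K$ that sends $o_\omega$ to $o$. -/

import Mathlib

open scoped ENNReal

noncomputable section

/-! ### Hilbert geometries -/

/-- `n`-dimensional real affine space, seen as the affine chart `{[x : 1]}` of the projective space
`ℙ(ℝⁿ × ℝ)`. -/
abbrev Chart (n : ℕ) : Type := EuclideanSpace ℝ (Fin n)

/-- The linear forms on `ℝⁿ × ℝ` that vanish at no point `[x : 1]` with `x ∈ Ω`, i.e. the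
(representatives of) the projective hyperplanes missing `Ω`. -/
def dualSet {n : ℕ} (Ω : Set (Chart n)) : Set (Module.Dual ℝ (Chart n × ℝ)) :=
  {φ | ∀ x ∈ Ω, φ (x, 1) ≠ 0}

/-- The cross-ratio `(φ, x, y, ψ)` of two points of the affine chart and two hyperplanes. -/
def crossRatio {n : ℕ} (φ : Module.Dual ℝ (Chart n × ℝ)) (x y : Chart n)
    (ψ : Module.Dual ℝ (Chart n × ℝ)) : ℝ :=
  (ψ (x, 1) / ψ (y, 1)) * (φ (y, 1) / φ (x, 1))

/-- The Hilbert distance `sup_{φ, ψ} log |(φ, x, y, ψ)|`, with values in `[0, ∞]`. Taking `φ = ψ`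
shows that the supremum is nonnegative, so truncating negative logarithms to `0` is harmless. -/
def hilbertEDist {n : ℕ} (Ω : Set (Chart n)) (x y : Chart n) : ℝ≥0∞ :=
  ⨆ φ ∈ dualSet Ω, ⨆ ψ ∈ dualSet Ω, ENNReal.ofReal (Real.log |crossRatio φ x y ψ|)

/-- The set `Ω`, to be endowed with its Hilbert distance. -/
@[ext] structure HilbertGeometry {n : ℕ} (Ω : Set (Chart n)) where
  val : Chart n
  property : val ∈ Ω

theorem hilbertEDist_triangle {n : ℕ} {Ω : Set (Chart n)} {x y z : Chart n}
    (hx : x ∈ Ω) (hy : y ∈ Ω) (hz : z ∈ Ω) :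
    hilbertEDist Ω x z ≤ hilbertEDist Ω x y + hilbertEDist Ω y z := by
  refine iSup₂_le fun φ hφ => iSup₂_le fun ψ hψ => ?_
  have key : Real.log |crossRatio φ x z ψ| =
      Real.log |crossRatio φ x y ψ| + Real.log |crossRatio φ y z ψ| := by
    have h1 := hφ x hx
    have h2 := hφ y hy
    have h3 := hφ z hz
    have h4 := hψ x hx
    have h5 := hψ y hy
    have h6 := hψ z hz
    rw [← Real.log_mul, ← abs_mul]
    · congr 2
      simp only [crossRatio]
      field_simp
    · simp [crossRatio, h1, h2, h4, h5]
    · simp [crossRatio, h2, h3, h5, h6]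
  rw [key]
  refine ENNReal.ofReal_add_le.trans (add_le_add ?_ ?_)
  · exact le_iSup₂_of_le φ hφ (le_iSup₂_of_le ψ hψ le_rfl)
  · exact le_iSup₂_of_le φ hφ (le_iSup₂_of_le ψ hψ le_rfl)

theorem hilbertEDist_comm_le {n : ℕ} (Ω : Set (Chart n)) (x y : Chart n) :
    hilbertEDist Ω x y ≤ hilbertEDist Ω y x := by
  refine iSup₂_le fun φ hφ => iSup₂_le fun ψ hψ => ?_
  refine le_iSup₂_of_le ψ hψ (le_iSup₂_of_le φ hφ ?_)
  rw [show crossRatio ψ y x φ = crossRatio φ x y ψ from mul_comm _ _]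

instance instHilbertGeometry {n : ℕ} (Ω : Set (Chart n)) : PseudoEMetricSpace (HilbertGeometry Ω) where
  edist x y := hilbertEDist Ω x.val y.val
  edist_self x := by
    refine le_antisymm (iSup₂_le fun φ hφ => iSup₂_le fun ψ hψ => ?_) bot_le
    simp [crossRatio, hφ x.val x.property, hψ x.val x.property]
  edist_comm x y := le_antisymm (hilbertEDist_comm_le Ω _ _) (hilbertEDist_comm_le Ω _ _)
  edist_triangle x y z := hilbertEDist_triangle x.property y.property z.property

/-! ### Asymptotic cones -/

/-- A scaling sequence: `λ_k ≥ 1` and `λ_k → ∞`. -/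
def IsScalingSequence (lam : ℕ → ℝ) : Prop :=
  (∀ k, 1 ≤ lam k) ∧ Filter.Tendsto lam Filter.atTop Filter.atTop

/-- `d_ω(x, y) = lim_ω d(x_k, y_k) / λ_k`, the limit being taken in the compact space `[0, ∞]`. -/
def ultraEDist {X : Type*} [PseudoEMetricSpace X] (ω : Ultrafilter ℕ) (lam : ℕ → ℝ)
    (x y : ℕ → X) : ℝ≥0∞ :=
  (ω.map fun k => edist (x k) (y k) / ENNReal.ofReal (lam k)).lim

theorem tendsto_ultraEDist {X : Type*} [PseudoEMetricSpace X] (ω : Ultrafilter ℕ) (lam : ℕ → ℝ)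
    (x y : ℕ → X) :
    Filter.Tendsto (fun k => edist (x k) (y k) / ENNReal.ofReal (lam k)) ω
      (nhds (ultraEDist ω lam x y)) :=
  Ultrafilter.le_nhds_lim (ω.map fun k => edist (x k) (y k) / ENNReal.ofReal (lam k))

theorem ultraEDist_self {X : Type*} [PseudoEMetricSpace X] (ω : Ultrafilter ℕ) (lam : ℕ → ℝ)
    (x : ℕ → X) : ultraEDist ω lam x x = 0 := by
  refine tendsto_nhds_unique (tendsto_ultraEDist ω lam x x) ?_
  simp

/-- The `ω`-bounded sequences: those at finite distance `d_ω` from the observation points `o`. -/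
@[ext] structure OmegaBounded {X : Type*} [PseudoEMetricSpace X] (ω : Ultrafilter ℕ)
    (lam : ℕ → ℝ) (o : ℕ → X) where
  seq : ℕ → X
  bounded : ultraEDist ω lam o seq < ⊤

instance instOmegaBounded {X : Type*} [PseudoEMetricSpace X] (ω : Ultrafilter ℕ) (lam : ℕ → ℝ) (o : ℕ → X) :
    PseudoEMetricSpace (OmegaBounded ω lam o) where
  edist x y := ultraEDist ω lam x.seq y.seq
  edist_self x := ultraEDist_self ω lam x.seq
  edist_comm x y := by
    refine tendsto_nhds_unique (tendsto_ultraEDist ω lam x.seq y.seq) ?_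
    simpa only [edist_comm] using tendsto_ultraEDist ω lam y.seq x.seq
  edist_triangle x y z := by
    refine le_of_tendsto_of_tendsto' (tendsto_ultraEDist ω lam x.seq z.seq)
      ((tendsto_ultraEDist ω lam x.seq y.seq).add (tendsto_ultraEDist ω lam y.seq z.seq))
      fun k => ?_
    rw [← ENNReal.add_div]
    exact ENNReal.div_le_div_right (edist_triangle _ _ _) _

/-- The asymptotic cone of `X` with respect to the ultrafilter `ω`, the scaling sequence `lam` and
the observation points `o`: `ω`-bounded sequences modulo `d_ω = 0`, with the metric `d_ω`. -/
abbrev AsymptoticCone {X : Type*} [PseudoEMetricSpace X] (ω : Ultrafilter ℕ) (lam : ℕ → ℝ)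
    (o : ℕ → X) : Type _ :=
  SeparationQuotient (OmegaBounded ω lam o)

/-- The base point of the asymptotic cone: the class of the sequence of observation points. -/
def AsymptoticCone.base {X : Type*} [PseudoEMetricSpace X] (ω : Ultrafilter ℕ) (lam : ℕ → ℝ)
    (o : ℕ → X) : AsymptoticCone ω lam o :=
  SeparationQuotient.mk ⟨o, by rw [ultraEDist_self]; exact ENNReal.zero_lt_top⟩

/-! ### Polytopes and flags -/

/-- A convex polytope: the convex hull of finitely many points. -/
def IsPolytope {n : ℕ} (P : Set (Chart n)) : Prop :=
  ∃ s : Set (Chart n), s.Finite ∧ P = convexHull ℝ s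

/-- The (nonempty, closed) faces of `P`: the sets where a linear form attains its maximum over `P`.
The zero form shows that `P` itself is a face. -/
def faces {n : ℕ} (P : Set (Chart n)) : Set (Set (Chart n)) :=
  {σ | σ.Nonempty ∧ IsExposed ℝ P σ}

/-- The dimension of a face. -/
def faceDim {n : ℕ} (σ : Set (Chart n)) : ℕ := Module.finrank ℝ (vectorSpan ℝ σ)

/-- A flag of `P` containing `P`: a set of faces of `P`, totally ordered by inclusion, with `P` as
a member. -/
@[ext] structure PointedFlag {n : ℕ} (P : Set (Chart n)) where
  members : Set (Set (Chart n))
  members_subset : members ⊆ faces P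
  isChain : IsChain (· ⊆ ·) members
  mem_self : P ∈ members

/-- The flag whose only member is `P`. -/
def PointedFlag.trivial {n : ℕ} {P : Set (Chart n)} (hP : P.Nonempty) : PointedFlag P where
  members := {P}
  members_subset := by
    rintro _ rfl
    exact ⟨hP, IsExposed.refl _⟩
  isChain := IsChain.singleton
  mem_self := rfl

/-- The type of a flag: the set of the dimensions of its members other than `P`. (The positions
`1, …, n` between consecutive coordinates of `ℝⁿ⁺¹` are numbered `0, …, n - 1` here, so a face of
dimension `i` contributes `i` instead of `i + 1`.) -/
def PointedFlag.flagType {n : ℕ} {P : Set (Chart n)} (F : PointedFlag P) : Set (Fin n) :=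
  {i | ∃ σ ∈ F.members, σ ≠ P ∧ faceDim σ = i}

/-! ### The model flat and its Weyl chamber -/

/-- The model flat `ℝⁿ⁺¹ / ℝ (1, …, 1)`. -/
abbrev ModelFlat (n : ℕ) : Type :=
  (Fin (n + 1) → ℝ) ⧸ Submodule.span ℝ {(1 : Fin (n + 1) → ℝ)}

/-- The norm `max_{i, j} |α_i - α_j|` on the model flat. -/
def hexNorm {n : ℕ} (a : ModelFlat n) : ℝ :=
  Quotient.liftOn' a
    (fun α => ⨆ p : Fin (n + 1) × Fin (n + 1), |α p.1 - α p.2|) fun α β h => by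
      obtain ⟨c, hc⟩ := Submodule.mem_span_singleton.1 ((Submodule.quotientRel_def _).1 h)
      refine iSup_congr fun p => ?_
      have h1 := congrFun hc p.1
      have h2 := congrFun hc p.2
      simp only [Pi.smul_apply, Pi.one_apply, Pi.sub_apply, smul_eq_mul, mul_one] at h1 h2
      congr 1
      linarith

/-- The face `𝔸⁺_D` of the closed Weyl chamber `α_0 ≥ α_1 ≥ … ≥ α_n`, cut out by the equations
`α_i = α_{i + 1}` for `i ∉ D`. -/
def chamberFace {n : ℕ} (D : Set (Fin n)) : Set (ModelFlat n) :=
  {a | ∃ α : Fin (n + 1) → ℝ, Submodule.Quotient.mk α = a ∧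
    (∀ i : Fin n, α i.succ ≤ α i.castSucc) ∧ ∀ i : Fin n, i ∉ D → α i.castSucc = α i.succ}

theorem zero_mem_chamberFace {n : ℕ} (D : Set (Fin n)) : (0 : ModelFlat n) ∈ chamberFace D :=
  ⟨0, rfl, fun _ => le_rfl, fun _ _ => rfl⟩

/-! ### Quotient pseudo-metrics -/

/-- `IsGluingChain r a [(x₁, y₁), …, (x_m, y_m)] b` says that `x₁` is in the class `a`, that `y_k` and
`x_{k + 1}` are in the same class for all `k < m`, and that `y_m` is in the class `b`; the empty list
is allowed as a chain from a class to itself. -/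
def IsGluingChain {X : Type*} (r : X → X → Prop) : Quot r → List (X × X) → Quot r → Prop
  | a, [], b => a = b
  | a, p :: l, b => Quot.mk r p.1 = a ∧ IsGluingChain r (Quot.mk r p.2) l b

/-- The length `∑ d(x_k, y_k)` of a chain. -/
def chainLength {X : Type*} (d : X → X → ℝ≥0∞) (l : List (X × X)) : ℝ≥0∞ :=
  (l.map fun p => d p.1 p.2).sum

/-- The quotient pseudo-metric: the infimum of the lengths of the chains between two classes. -/
def quotientEDist {X : Type*} (d : X → X → ℝ≥0∞) (r : X → X → Prop) (a b : Quot r) : ℝ≥0∞ :=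
  ⨅ (l : List (X × X)) (_ : IsGluingChain r a l b), chainLength d l

theorem IsGluingChain.append {X : Type*} {r : X → X → Prop} {l : List (X × X)} :
    ∀ {a b c : Quot r} {l' : List (X × X)}, IsGluingChain r a l b → IsGluingChain r b l' c →
      IsGluingChain r a (l ++ l') c := by
  induction l with
  | nil => intro a b c l' h h'; cases h; exact h'
  | cons p l ih => intro a b c l' h h'; exact ⟨h.1, ih h.2 h'⟩

theorem IsGluingChain.reverse {X : Type*} {r : X → X → Prop} {l : List (X × X)} :
    ∀ {a b : Quot r}, IsGluingChain r a l b →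
      IsGluingChain r b (l.map Prod.swap).reverse a := by
  induction l with
  | nil => intro a b h; exact Eq.symm h
  | cons p l ih =>
    intro a b h
    rw [List.map_cons, List.reverse_cons]
    exact (ih h.2).append ⟨rfl, h.1⟩

theorem quotientEDist_comm_le {X : Type*} {d : X → X → ℝ≥0∞} (hd : ∀ x y, d x y = d y x)
    (r : X → X → Prop) (a b : Quot r) : quotientEDist d r a b ≤ quotientEDist d r b a := by
  refine le_iInf₂ fun l hl => iInf₂_le_of_le _ hl.reverse ?_
  simp [chainLength, List.sum_reverse, Function.comp_def, hd]

theorem quotientEDist_triangle {X : Type*} (d : X → X → ℝ≥0∞)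
    (r : X → X → Prop) (a b c : Quot r) :
    quotientEDist d r a c ≤ quotientEDist d r a b + quotientEDist d r b c := by
  simp only [quotientEDist, ENNReal.add_iInf, ENNReal.iInf_add]
  refine le_iInf₂ fun l' hl' => le_iInf₂ fun l hl => ?_
  refine iInf₂_le_of_le _ (hl.append hl') ?_
  simp [chainLength]

/-! ### The geometric realization of the flag complex over a Weyl chamber -/

/-- The disjoint union of the `𝔸⁺_{D(F)}` over the flags `F` of `P` containing `P`. -/
abbrev ChamberUnion {n : ℕ} (P : Set (Chart n)) : Type :=
  (F : PointedFlag P) × chamberFace F.flagType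

open Classical in
/-- The metric on the disjoint union: `d_H` on each piece, `∞` between different pieces. -/
def chamberUnionEDist {n : ℕ} {P : Set (Chart n)} (p q : ChamberUnion P) : ℝ≥0∞ :=
  if p.1 = q.1 then ENNReal.ofReal (hexNorm ((p.2 : ModelFlat n) - (q.2 : ModelFlat n))) else ⊤

/-- `(x, F)` is glued to `(x, F')` when `F` is contained in `F'`. -/
def chamberGlue {n : ℕ} {P : Set (Chart n)} (p q : ChamberUnion P) : Prop :=
  p.1.members ⊆ q.1.members ∧ (p.2 : ModelFlat n) = (q.2 : ModelFlat n)

/-- The geometric realization `K(P, ℝ)`: the quotient of the disjoint union by the equivalence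
relation generated by the gluings. -/
def FlagRealization {n : ℕ} (P : Set (Chart n)) : Type :=
  Quot (chamberGlue (P := P))

theorem hexNorm_sub_comm {n : ℕ} (a b : ModelFlat n) : hexNorm (a - b) = hexNorm (b - a) := by
  induction a using Submodule.Quotient.induction_on with | _ α
  induction b using Submodule.Quotient.induction_on with | _ β
  refine iSup_congr fun p => ?_
  rw [← abs_neg]
  congr 1
  simp only [Pi.sub_apply]
  ring

theorem chamberUnionEDist_comm {n : ℕ} {P : Set (Chart n)} (p q : ChamberUnion P) :
    chamberUnionEDist p q = chamberUnionEDist q p := by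
  unfold chamberUnionEDist
  rw [hexNorm_sub_comm]
  by_cases h : p.1 = q.1
  · rw [if_pos h, if_pos h.symm]
  · rw [if_neg h, if_neg (Ne.symm h)]

/-- `K(P, ℝ)` carries the quotient pseudo-metric. -/
instance instFlagRealization {n : ℕ} (P : Set (Chart n)) : PseudoEMetricSpace (FlagRealization P) where
  edist := quotientEDist chamberUnionEDist chamberGlue
  edist_self a := le_antisymm (iInf₂_le_of_le [] rfl (by simp [chainLength])) bot_le
  edist_comm a b := le_antisymm (quotientEDist_comm_le chamberUnionEDist_comm _ _ _)
    (quotientEDist_comm_le chamberUnionEDist_comm _ _ _)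
  edist_triangle a b c := quotientEDist_triangle _ _ _ _ _

/-- The cone point `o` of `K(P, ℝ)`: the common class of all the `(0, F)`. -/
def FlagRealization.conePoint {n : ℕ} {P : Set (Chart n)} (hP : P.Nonempty) : FlagRealization P :=
  Quot.mk _ ⟨PointedFlag.trivial hP, 0, zero_mem_chamberFace _⟩

end

/-!
# Asymptotic cones of polytopal Hilbert geometries

By the Minkowski–Weyl theorem the cone of the linear forms that are nonnegative on `P` is generated
by finitely many forms `u_i`, the constant form `1` being included among them. Consequently the Hilbert
distance is `max_{i, j} |a_i - a_j|` for `a_i = log u_i(x) - log u_i(y)`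
(`SupportingSystem.hilbertEDist_eq`): the map `x ↦ (log u_i(x))_i` is an isometric embedding for the
seminorm `spread`. Dividing by `λ_k` and passing to the `ω`-limit embeds the asymptotic cone
isometrically into `ι → ℝ`, by `τ_i = lim_ω log u_i(x_k) / λ_k`.

The image is the set `SupportingSystem.tropicalSet` of the families `τ` with `τ_top = 0`, `top` being
the index of the constant form, all of whose sublevel sets `{i | τ_i < c}` have the form
`{i | u_i vanishes on A}` for some `A ⊆ P`. That limits have this property is seen by writing `x_k` as
a barycenter of the finitely many points spanning `P` (`IsLogLimit.mem_tropicalSet`); conversely `τ`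
is realized by barycenters with weights proportional to `exp (λ_k τ_i)`
(`exists_isLogLimit_eq`).

The flag realization has the same image. For a flag `F` and a point `α` of its chamber face, let
`τ_i = α_{dim σ} - α_0`, where `σ` is the smallest member of `F` on which `u_i` does not vanish. The
common zero sets in `P` of the `u_i` with `τ_i < c`, for `c ≤ 0`, are members of `F`, and their
dimensions recover `α`. Hence the map is injective on the realization, with image the whole tropical
set (`realizationExponent_injective`, `range_realizationExponent`), and it is isometric on each
chamber face (`spread_exponent_sub`).

It remains to compare the quotient metric with `spread`. One inequality is the triangle inequality
along a chain. For the other, the tropical set is closed under the tropical segments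
`s ↦ max (s + τ, τ') - max (s, 0)`, which are geodesics for `spread`; such a segment is covered by the
finitely many closed images of the chamber faces, so it decomposes into finitely many links of a
chain without loss of length (`edist_le_of_closed_cover`, `edist_eq_ofReal_spread`).
-/

noncomputable section

/-! ### Finite generation of polyhedral cones -/

section MinkowskiWeyl

variable {V : Type*} [AddCommGroup V] [Module ℝ V]

/-- One step of the Fourier–Motzkin elimination: the part of a finitely generated cone lying in a
half-space is finitely generated, by the generators in that half-space and by the combinations of
two generators that lie on the bounding hyperplane. -/
theorem PointedCone.exists_finset_span_halfspace [DecidableEq V] (G : Finset V) (v : V →ₗ[ℝ] ℝ) :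
    ∃ G' : Finset V, (∀ g ∈ G', 0 ≤ v g ∧ g ∈ Submodule.span NNReal (G : Set V)) ∧
      ∀ x ∈ Submodule.span NNReal (G : Set V), 0 ≤ v x →
      x ∈ Submodule.span NNReal (G' : Set V) := by
  refine ⟨G.filter (fun g => 0 ≤ v g) ∪
    ((G ×ˢ G).filter (fun p => 0 ≤ v p.1 ∧ v p.2 < 0)).image
      (fun p => v p.1 • p.2 - v p.2 • p.1), fun g hg => ?_, fun x hx hvx => ?_⟩
  · rcases Finset.mem_union.1 hg with hg | hg
    · exact ⟨(Finset.mem_filter.1 hg).2, Submodule.subset_span (Finset.mem_filter.1 hg).1⟩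
    · obtain ⟨⟨a, b⟩, hab, rfl⟩ := Finset.mem_image.1 hg
      obtain ⟨hmem, ha, hb⟩ := Finset.mem_filter.1 hab
      obtain ⟨haG, hbG⟩ := Finset.mem_product.1 hmem
      refine ⟨by simp [mul_comm], ?_⟩
      rw [sub_eq_add_neg, ← neg_smul]
      exact Submodule.add_mem _
        (Submodule.smul_mem _ (⟨_, ha⟩ : NNReal) (Submodule.subset_span hbG))
        (Submodule.smul_mem _ (⟨_, neg_nonneg.2 hb.le⟩ : NNReal) (Submodule.subset_span haG))
  set G' := G.filter (fun g => 0 ≤ v g) ∪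
    ((G ×ˢ G).filter (fun p => 0 ≤ v p.1 ∧ v p.2 < 0)).image
      (fun p => v p.1 • p.2 - v p.2 • p.1) with hG'
  obtain ⟨c, -, rfl⟩ := Submodule.mem_span_finset.1 hx
  have hsmul : ∀ (r : ℝ) (y : V), 0 ≤ r → y ∈ Submodule.span NNReal (G' : Set V) →
      r • y ∈ Submodule.span NNReal (G' : Set V) := fun r y hr hy =>
    Submodule.smul_mem _ (⟨r, hr⟩ : NNReal) hy
  have hmem1 : ∀ g ∈ G, 0 ≤ v g → g ∈ Submodule.span NNReal (G' : Set V) := fun g hg h =>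
    Submodule.subset_span (by simp [hG', hg, h])
  have hmem2 : ∀ g ∈ G, 0 ≤ v g → ∀ h ∈ G, v h < 0 →
      v g • h - v h • g ∈ Submodule.span NNReal (G' : Set V) :=
    fun g hg hg0 h hh hh0 => Submodule.subset_span (Finset.mem_coe.2 (Finset.mem_union_right _
      (Finset.mem_image.2 ⟨(g, h), by simp [hg, hh, hg0, hh0], rfl⟩)))
  set Gp := G.filter (fun g => 0 ≤ v g) with hGp
  set Gn := G.filter (fun g => ¬ 0 ≤ v g) with hGn
  have hsplit : ∀ {M : Type _} [AddCommMonoid M] (f : V → M),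
      ∑ g ∈ G, f g = ∑ g ∈ Gp, f g + ∑ g ∈ Gn, f g := fun f =>
    (Finset.sum_filter_add_sum_filter_not G _ f).symm
  set A := ∑ g ∈ Gp, (c g : ℝ) * v g with hA
  set B := ∑ g ∈ Gn, (c g : ℝ) * v g with hB
  have hAB : 0 ≤ A + B := by
    have : v (∑ g ∈ G, c g • g) = A + B := by
      rw [map_sum, hA, hB, hsplit]
      simp [NNReal.smul_def]
    rwa [this] at hvx
  have hB0 : B ≤ 0 := Finset.sum_nonpos fun g hg =>
    mul_nonpos_of_nonneg_of_nonpos (c g).2 (not_le.1 (Finset.mem_filter.1 hg).2).le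
  have hsum : ∑ g ∈ G, c g • g = ∑ g ∈ Gp, (c g : ℝ) • g + ∑ g ∈ Gn, (c g : ℝ) • g := by
    rw [hGp, hGn, Finset.sum_filter_add_sum_filter_not]; rfl
  rcases (show 0 ≤ A by linarith).eq_or_lt with hA0 | hA0
  · have hB' : B = 0 := by linarith
    have hc : ∀ g ∈ Gn, (c g : ℝ) = 0 := by
      intro g hg
      have hneg := not_le.1 (Finset.mem_filter.1 hg).2
      have := (Finset.sum_eq_zero_iff_of_nonpos fun g hg =>
        mul_nonpos_of_nonneg_of_nonpos (c g).2
          (not_le.1 (Finset.mem_filter.1 hg).2).le).1 hB' g hg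
      exact (mul_eq_zero.1 this).resolve_right hneg.ne
    rw [hsum, Finset.sum_eq_zero (s := Gn) fun g hg => by rw [hc g hg, zero_smul], add_zero]
    exact Submodule.sum_mem _ fun g hg => hsmul _ _ (c g).2
      (hmem1 g (Finset.mem_filter.1 hg).1 (Finset.mem_filter.1 hg).2)
  · have hcomb : ∑ g ∈ Gp, ∑ h ∈ Gn, ((c g : ℝ) * c h / A) • (v g • h - v h • g) =
        ∑ h ∈ Gn, (c h : ℝ) • h - (B / A) • ∑ g ∈ Gp, (c g : ℝ) • g := by
      simp only [smul_sub, Finset.sum_sub_distrib]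
      congr 1
      · rw [Finset.sum_comm]
        refine Finset.sum_congr rfl fun h _ => ?_
        simp only [smul_smul]
        rw [← Finset.sum_smul]
        congr 1
        rw [show ∑ g ∈ Gp, (c g : ℝ) * c h / A * v g = A * (c h / A) by
          rw [hA, Finset.sum_mul]; exact Finset.sum_congr rfl fun g _ => by ring]
        field_simp
      · rw [Finset.smul_sum]
        refine Finset.sum_congr rfl fun g _ => ?_
        simp only [smul_smul]
        rw [← Finset.sum_smul]
        congr 1
        rw [hB, Finset.sum_div, Finset.sum_mul]
        exact Finset.sum_congr rfl fun h _ => by ring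
    have key : ∑ g ∈ G, c g • g = (1 + B / A) • ∑ g ∈ Gp, (c g : ℝ) • g +
        ∑ g ∈ Gp, ∑ h ∈ Gn, ((c g : ℝ) * c h / A) • (v g • h - v h • g) := by
      rw [hcomb, hsum, add_smul, one_smul]
      abel
    rw [key]
    refine Submodule.add_mem _ (hsmul _ _ ?_ ?_) ?_
    · rw [← div_self hA0.ne', ← add_div]
      exact div_nonneg hAB hA0.le
    · exact Submodule.sum_mem _ fun g hg => hsmul _ _ (c g).2
        (hmem1 g (Finset.mem_filter.1 hg).1 (Finset.mem_filter.1 hg).2)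
    · exact Submodule.sum_mem _ fun g hg => Submodule.sum_mem _ fun h hh =>
        hsmul _ _ (div_nonneg (mul_nonneg (c g).2 (c h).2) hA0.le)
          (hmem2 g (Finset.mem_filter.1 hg).1 (Finset.mem_filter.1 hg).2 h
            (Finset.mem_filter.1 hh).1 (not_le.1 (Finset.mem_filter.1 hh).2))

/-- **Minkowski–Weyl theorem** for cones cut out by finitely many homogeneous inequalities. -/
theorem PointedCone.exists_finset_generators [FiniteDimensional ℝ V] (s : Finset (V →ₗ[ℝ] ℝ)) :
    ∃ G : Finset V, (∀ g ∈ G, ∀ v ∈ s, 0 ≤ v g) ∧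
      ∀ x, (∀ v ∈ s, 0 ≤ v x) → x ∈ Submodule.span NNReal (G : Set V) := by
  classical
  induction s using Finset.induction_on with
  | empty =>
    let b := Module.finBasis ℝ V
    refine ⟨Finset.univ.image b ∪ Finset.univ.image (fun i => -b i), by simp, fun x _ => ?_⟩
    rw [← b.sum_repr x]
    refine Submodule.sum_mem _ fun i _ => ?_
    rcases le_total 0 (b.repr x i) with h | h
    · exact Submodule.smul_mem _ (⟨_, h⟩ : NNReal) (Submodule.subset_span (by simp))
    · rw [show b.repr x i • b i = (-b.repr x i) • (-b i) by simp]
      exact Submodule.smul_mem _ (⟨_, neg_nonneg.2 h⟩ : NNReal) (Submodule.subset_span (by simp))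
  | insert v s _ ih =>
    obtain ⟨G, hG, hspan⟩ := ih
    obtain ⟨G', hG', hspan'⟩ := PointedCone.exists_finset_span_halfspace G v
    refine ⟨G', fun g hg w hw => ?_, fun x hx => ?_⟩
    · rcases Finset.mem_insert.1 hw with rfl | hw
      · exact (hG' g hg).1
      · obtain ⟨c, -, hc⟩ := Submodule.mem_span_finset.1 (hG' g hg).2
        rw [← hc, map_sum]
        refine Finset.sum_nonneg fun a ha => ?_
        rw [NNReal.smul_def, map_smul]
        exact mul_nonneg (c a).2 (hG a ha w hw)
    · exact hspan' x (hspan x fun w hw => hx w (Finset.mem_insert_of_mem hw))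
        (hx v (Finset.mem_insert_self v s))

end MinkowskiWeyl

/-! ### The spread of a finite family of reals -/

/-- The largest difference `max_{i, j} |a_i - a_j|` between two entries of a finite family: the
seminorm on `ι → ℝ` that induces the norm of the model flat. -/
def spread {ι : Type*} (a : ι → ℝ) : ℝ := ⨆ p : ι × ι, |a p.1 - a p.2|

section Spread

variable {ι : Type*}

theorem abs_sub_le_spread [Finite ι] (a : ι → ℝ) (i j : ι) : |a i - a j| ≤ spread a :=
  le_ciSup (f := fun p : ι × ι => |a p.1 - a p.2|) (Set.finite_range _).bddAbove (i, j)

theorem sub_le_spread [Finite ι] (a : ι → ℝ) (i j : ι) : a i - a j ≤ spread a :=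
  (le_abs_self _).trans (abs_sub_le_spread a i j)

theorem spread_nonneg (a : ι → ℝ) : 0 ≤ spread a := Real.iSup_nonneg fun _ => abs_nonneg _

theorem spread_le [Nonempty ι] {a : ι → ℝ} {r : ℝ} (h : ∀ i j, a i - a j ≤ r) : spread a ≤ r :=
  ciSup_le fun p => abs_le.2 ⟨by linarith [h p.2 p.1], h p.1 p.2⟩

theorem exists_spread_eq [Finite ι] [Nonempty ι] (a : ι → ℝ) : ∃ i j, spread a = a i - a j := by
  obtain ⟨⟨i, j⟩, hp⟩ := exists_eq_ciSup_of_finite (f := fun p : ι × ι => |a p.1 - a p.2|)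
  change |a i - a j| = spread a at hp
  rcases abs_choice (a i - a j) with h | h
  · exact ⟨i, j, by rw [← hp, h]⟩
  · exact ⟨j, i, by rw [← hp, h]; ring⟩

theorem spread_add_le [Finite ι] [Nonempty ι] (a b : ι → ℝ) : spread (a + b) ≤ spread a + spread b :=
  spread_le fun i j => by
    have h1 := sub_le_spread a i j
    have h2 := sub_le_spread b i j
    simp only [Pi.add_apply]
    linarith

theorem continuous_spread [Finite ι] [Nonempty ι] : Continuous (spread : (ι → ℝ) → ℝ) := by
  have := Fintype.ofFinite ι
  have h : (spread : (ι → ℝ) → ℝ) = fun a =>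
      Finset.univ.sup' Finset.univ_nonempty fun p : ι × ι => |a p.1 - a p.2| :=
    funext fun a => (Finset.sup'_univ_eq_ciSup _).symm
  rw [h]
  exact Continuous.finset_sup'_apply _ fun p _ => by fun_prop

theorem spread_smul [Nonempty ι] {r : ℝ} (hr : 0 ≤ r) (a : ι → ℝ) :
    spread (r • a) = r * spread a := by
  simp only [spread, Real.mul_iSup_of_nonneg hr, Pi.smul_apply, smul_eq_mul, ← mul_sub, abs_mul,
    abs_of_nonneg hr]

end Spread

/-! ### Supporting forms of a polytope and the Hilbert distance -/

/-- A finite family of linear forms that generates the cone of all the linear forms on `ℝⁿ × ℝ` that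
are nonnegative on `P` (seen in the affine chart). The constant form `(x, t) ↦ t` is required to be a
member, with index `top`; it serves to normalize the others. -/
structure SupportingSystem {n : ℕ} (P : Set (Chart n)) (ι : Type*) [Fintype ι] where
  form : ι → Module.Dual ℝ (Chart n × ℝ)
  top : ι
  form_top : form top = LinearMap.snd ℝ (Chart n) ℝ
  form_nonneg : ∀ i, ∀ x ∈ P, 0 ≤ form i (x, 1)
  form_ne_zero : ∀ i, form i ≠ 0
  generates : ∀ ψ : Module.Dual ℝ (Chart n × ℝ), (∀ x ∈ P, 0 ≤ ψ (x, 1)) →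
    ∃ c : ι → ℝ, (∀ i, 0 ≤ c i) ∧ ψ = ∑ i, c i • form i

/-- A linear form on `ℝⁿ × ℝ`, restricted to the affine chart, respects barycenters. -/
theorem dual_chart_sum {n : ℕ} {κ : Type*} (ψ : Module.Dual ℝ (Chart n × ℝ)) (t : Finset κ)
    (w : κ → ℝ) (hw : ∑ k ∈ t, w k = 1) (x : κ → Chart n) :
    ψ (∑ k ∈ t, w k • x k, 1) = ∑ k ∈ t, w k * ψ (x k, 1) := by
  have : ((∑ k ∈ t, w k • x k, 1) : Chart n × ℝ) = ∑ k ∈ t, w k • (x k, (1 : ℝ)) := by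
    ext1
    · simp [Prod.fst_sum]
    · simp [Prod.snd_sum, hw]
  rw [this, map_sum]
  exact Finset.sum_congr rfl fun k _ => map_smul ψ _ _

theorem continuous_dual_chart {n : ℕ} (ψ : Module.Dual ℝ (Chart n × ℝ)) :
    Continuous fun x : Chart n => ψ (x, 1) :=
  (LinearMap.continuous_of_finiteDimensional ψ).comp (by fun_prop)

theorem IsPolytope.isCompact {n : ℕ} {P : Set (Chart n)} (hP : IsPolytope P) : IsCompact P := by
  obtain ⟨s, hs, rfl⟩ := hP
  exact hs.isCompact_convexHull ℝ

theorem IsPolytope.convex {n : ℕ} {P : Set (Chart n)} (hP : IsPolytope P) : Convex ℝ P := by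
  obtain ⟨s, hs, rfl⟩ := hP
  exact convex_convexHull ℝ s

theorem IsPolytope.exists_supportingSystem {n : ℕ} {P : Set (Chart n)} (hP : IsPolytope P) :
    ∃ E : Finset (Module.Dual ℝ (Chart n × ℝ)), Nonempty (SupportingSystem P E) := by
  classical
  obtain ⟨s, hs, rfl⟩ := hP
  obtain ⟨G, hG, hspan⟩ := PointedCone.exists_finset_generators
    (hs.toFinset.image fun v => Module.Dual.eval ℝ (Chart n × ℝ) (v, 1))
  have hGs : ∀ g ∈ G, ∀ x ∈ convexHull ℝ s, 0 ≤ g (x, 1) := by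
    intro g hg x hx
    rw [← hs.coe_toFinset, Finset.mem_convexHull'] at hx
    obtain ⟨w, hw0, hw1, rfl⟩ := hx
    rw [dual_chart_sum g _ _ hw1]
    exact Finset.sum_nonneg fun v hv => mul_nonneg (hw0 v hv)
      (hG g hg _ (Finset.mem_image_of_mem _ hv))
  have hsnd : LinearMap.snd ℝ (Chart n) ℝ ≠ 0 := fun h => by
    simpa using LinearMap.congr_fun h ((0 : Chart n), (1 : ℝ))
  set E := (insert (LinearMap.snd ℝ (Chart n) ℝ) G).erase 0 with hE
  refine ⟨E, ⟨⟨Subtype.val, ⟨LinearMap.snd ℝ (Chart n) ℝ, by simp [hE, hsnd]⟩, rfl, ?_, ?_, ?_⟩⟩⟩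
  · rintro ⟨g, hg⟩ x hx
    rcases Finset.mem_insert.1 (Finset.mem_of_mem_erase hg) with rfl | hg
    · simp
    · exact hGs g hg x hx
  · rintro ⟨g, hg⟩
    exact Finset.ne_of_mem_erase hg
  · intro ψ hψ
    have h1 := hspan ψ fun v hv => by
      obtain ⟨x, hx, rfl⟩ := Finset.mem_image.1 hv
      exact hψ x (subset_convexHull ℝ s (hs.mem_toFinset.1 hx))
    have h2 : ψ ∈ Submodule.span NNReal (E : Set (Module.Dual ℝ (Chart n × ℝ))) := by
      rw [← Submodule.span_sdiff_singleton_zero] at h1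
      refine Submodule.span_mono (fun g hg => ?_) h1
      exact Finset.mem_coe.2 (Finset.mem_erase.2 ⟨hg.2, Finset.mem_insert_of_mem hg.1⟩)
    obtain ⟨c, -, hc⟩ := Submodule.mem_span_finset.1 h2
    refine ⟨fun i => c i.1, fun i => (c i.1).2, ?_⟩
    rw [← hc, ← Finset.sum_coe_sort]
    rfl

/-- A nonzero form that is nonnegative on a set is positive on its interior. -/
theorem dual_pos_of_mem_interior {n : ℕ} {P : Set (Chart n)} {ψ : Module.Dual ℝ (Chart n × ℝ)}
    (hψ : ψ ≠ 0) (h : ∀ x ∈ P, 0 ≤ ψ (x, 1)) {x : Chart n} (hx : x ∈ interior P) :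
    0 < ψ (x, 1) := by
  refine (h x (interior_subset hx)).lt_of_ne' fun h0 => hψ ?_
  have hdir : ∀ y : Chart n, 0 ≤ ψ (y, 0) := by
    intro y
    have hc : Filter.Tendsto (fun t : ℝ => x + t • y) (nhdsWithin 0 (Set.Ioi 0)) (nhds x) := by
      have : Continuous fun t : ℝ => x + t • y := by fun_prop
      simpa using (this.tendsto 0).mono_left nhdsWithin_le_nhds
    obtain ⟨t, ht, ht0⟩ := ((hc.eventually (mem_interior_iff_mem_nhds.1 hx)).and
      self_mem_nhdsWithin).exists
    have h1 := h _ ht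
    rw [show ((x + t • y, 1) : Chart n × ℝ) = (x, 1) + t • (y, 0) by ext1 <;> simp, map_add, h0,
      map_smul, zero_add] at h1
    exact nonneg_of_mul_nonneg_right h1 ht0
  have hdir0 : ∀ y : Chart n, ψ (y, 0) = 0 := fun y => by
    refine le_antisymm ?_ (hdir y)
    have := hdir (-y)
    rw [show ((-y, 0) : Chart n × ℝ) = -(y, 0) by simp, map_neg] at this
    linarith
  refine LinearMap.ext fun p => ?_
  rw [show p = p.2 • (x, (1 : ℝ)) + (p.1 - p.2 • x, 0) by ext1 <;> simp, map_add, map_smul, h0,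
    hdir0]
  simp

/-- A form without zeros on the interior of a convex body has constant sign on the body. -/
theorem dualSet_interior_sign {n : ℕ} {P : Set (Chart n)} (hconv : Convex ℝ P)
    (hint : (interior P).Nonempty) {ψ : Module.Dual ℝ (Chart n × ℝ)}
    (hψ : ψ ∈ dualSet (interior P)) :
    (∀ x ∈ P, 0 ≤ ψ (x, 1)) ∨ ∀ x ∈ P, 0 ≤ (-ψ) (x, 1) := by
  have hcont := continuous_dual_chart ψ
  have hsub : P ⊆ closure (interior P) := by
    rw [hconv.closure_interior_eq_closure_of_nonempty_interior hint]
    exact subset_closure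
  have key : (∀ x ∈ interior P, 0 ≤ ψ (x, 1)) ∨ ∀ x ∈ interior P, ψ (x, 1) ≤ 0 := by
    by_contra! hcon
    obtain ⟨⟨x, hx, hx0⟩, y, hy, hy0⟩ := hcon
    obtain ⟨z, hz, hz0⟩ := hconv.interior.isPreconnected.intermediate_value hx hy
      hcont.continuousOn ⟨hx0.le, hy0.le⟩
    exact hψ z hz hz0
  rcases key with h | h
  · left
    intro x hx
    exact closure_minimal h (isClosed_le continuous_const hcont) (hsub hx)
  · right
    intro x hx
    exact neg_nonneg.2 (closure_minimal h (isClosed_le hcont continuous_const) (hsub hx))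

namespace SupportingSystem

variable {n : ℕ} {P : Set (Chart n)} {ι : Type*} [Fintype ι]

/-- The value of the `i`-th supporting form at a point of the affine chart. -/
def val (S : SupportingSystem P ι) (i : ι) (x : Chart n) : ℝ := S.form i (x, 1)

theorem val_top (S : SupportingSystem P ι) (x : Chart n) : S.val S.top x = 1 := by
  simp [val, S.form_top]

theorem val_nonneg (S : SupportingSystem P ι) (i : ι) {x : Chart n} (hx : x ∈ P) : 0 ≤ S.val i x :=
  S.form_nonneg i x hx

theorem val_sum (S : SupportingSystem P ι) (i : ι) {κ : Type*} (t : Finset κ) (w : κ → ℝ)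
    (hw : ∑ k ∈ t, w k = 1) (x : κ → Chart n) :
    S.val i (∑ k ∈ t, w k • x k) = ∑ k ∈ t, w k * S.val i (x k) :=
  dual_chart_sum _ t w hw x

theorem continuous_val (S : SupportingSystem P ι) (i : ι) : Continuous (S.val i) :=
  continuous_dual_chart _

theorem val_pos (S : SupportingSystem P ι) (i : ι) {x : Chart n} (hx : x ∈ interior P) :
    0 < S.val i x :=
  dual_pos_of_mem_interior (S.form_ne_zero i) (S.form_nonneg i) hx

theorem mem_of_val_nonneg (S : SupportingSystem P ι) (hP : IsPolytope P) {x : Chart n}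
    (hx : ∀ i, 0 ≤ S.val i x) : x ∈ P := by
  by_contra hxP
  obtain ⟨f, u, hf, hu⟩ := geometric_hahn_banach_closed_point hP.convex hP.isCompact.isClosed hxP
  let ψ : Module.Dual ℝ (Chart n × ℝ) :=
    u • LinearMap.snd ℝ (Chart n) ℝ - f.toLinearMap ∘ₗ LinearMap.fst ℝ (Chart n) ℝ
  have hψ : ∀ y, ψ (y, 1) = u - f y := fun y => by simp [ψ]
  obtain ⟨c, hc, hsum⟩ := S.generates ψ fun y hy => by
    rw [hψ]; linarith [hf y hy]
  have h1 : 0 ≤ ψ (x, 1) := by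
    rw [hsum, LinearMap.sum_apply]
    exact Finset.sum_nonneg fun i _ => mul_nonneg (hc i) (hx i)
  rw [hψ] at h1
  linarith

theorem mem_interior_of_val_pos (S : SupportingSystem P ι) (hP : IsPolytope P) {x : Chart n}
    (hx : ∀ i, 0 < S.val i x) : x ∈ interior P := by
  refine interior_maximal (s := P) (t := {y | ∀ i, 0 < S.val i y})
    (fun y hy => S.mem_of_val_nonneg hP fun i => (hy i).le) ?_ hx
  simp only [Set.ofPred_forall]
  exact isOpen_iInter_of_finite fun i => isOpen_lt continuous_const (S.continuous_val i)

/-- The ratio of the values of a form at two interior points is controlled by the ratios for the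
supporting forms. -/
theorem dual_div_le (S : SupportingSystem P ι) {ψ : Module.Dual ℝ (Chart n × ℝ)}
    (hψ : ψ ≠ 0) (h : ∀ x ∈ P, 0 ≤ ψ (x, 1)) {x y : Chart n}
    (hy : y ∈ interior P) :
    ∃ i, ψ (x, 1) / ψ (y, 1) ≤ S.val i x / S.val i y := by
  have hψy := dual_pos_of_mem_interior hψ h hy
  obtain ⟨i, -, hi⟩ := Finset.exists_max_image Finset.univ (fun i => S.val i x / S.val i y)
    ⟨S.top, Finset.mem_univ _⟩
  refine ⟨i, ?_⟩
  rw [div_le_iff₀ hψy]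
  obtain ⟨c, hc, hsum⟩ := S.generates ψ h
  have hval : ∀ z, ψ (z, 1) = ∑ j, c j * S.val j z := fun z => by
    rw [hsum, LinearMap.sum_apply]; rfl
  rw [hval, hval, Finset.mul_sum]
  refine Finset.sum_le_sum fun j _ => ?_
  have h1 := (div_le_iff₀ (S.val_pos j hy)).1 (hi j (Finset.mem_univ j))
  calc c j * S.val j x ≤ c j * (S.val i x / S.val i y * S.val j y) :=
        mul_le_mul_of_nonneg_left h1 (hc j)
    _ = _ := by ring

/-- The Hilbert distance of a polytope is the pullback of the spread seminorm under the map given by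
the logarithms of the supporting forms. -/
theorem hilbertEDist_eq (S : SupportingSystem P ι) (hP : IsPolytope P) {x y : Chart n}
    (hx : x ∈ interior P) (hy : y ∈ interior P) :
    hilbertEDist (interior P) x y =
      ENNReal.ofReal (spread fun i => Real.log (S.val i x) - Real.log (S.val i y)) := by
  have : Nonempty ι := ⟨S.top⟩
  have hlog : ∀ i, Real.log (S.val i x) - Real.log (S.val i y) =
      Real.log (S.val i x / S.val i y) := fun i =>
    (Real.log_div (S.val_pos i hx).ne' (S.val_pos i hy).ne').symm
  refine le_antisymm (iSup₂_le fun φ hφ => iSup₂_le fun ψ hψ => ENNReal.ofReal_le_ofReal ?_) ?_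
  · have key : ∀ {ψ : Module.Dual ℝ (Chart n × ℝ)}, ψ ∈ dualSet (interior P) →
        ∀ {x y}, x ∈ interior P → y ∈ interior P → ∃ i, Real.log |ψ (x, 1) / ψ (y, 1)| ≤
          Real.log (S.val i x / S.val i y) := by
      intro ψ hψ x y hx hy
      have hψ0 : ψ ≠ 0 := fun h => hψ x hx (by simp [h])
      rcases dualSet_interior_sign hP.convex ⟨x, hx⟩ hψ with h | h
      · obtain ⟨i, hi⟩ := S.dual_div_le hψ0 h hy
        have hpos := div_pos (dual_pos_of_mem_interior hψ0 h hx)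
          (dual_pos_of_mem_interior hψ0 h hy)
        exact ⟨i, by rw [abs_of_pos hpos]; exact Real.log_le_log hpos hi⟩
      · obtain ⟨i, hi⟩ := S.dual_div_le (neg_ne_zero.2 hψ0) h hy
        have hpos := div_pos (dual_pos_of_mem_interior (neg_ne_zero.2 hψ0) h hx)
          (dual_pos_of_mem_interior (neg_ne_zero.2 hψ0) h hy)
        have heq : (-ψ) (x, 1) / (-ψ) (y, 1) = ψ (x, 1) / ψ (y, 1) := by
          simp [neg_div_neg_eq]
        rw [heq] at hi hpos
        exact ⟨i, by rw [abs_of_pos hpos]; exact Real.log_le_log hpos hi⟩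
    obtain ⟨i, hi⟩ := key hψ hx hy
    obtain ⟨j, hj⟩ := key hφ hy hx
    have h1 := sub_le_spread (fun i => Real.log (S.val i x) - Real.log (S.val i y)) i j
    simp only [hlog] at h1 ⊢
    rw [crossRatio, abs_mul, Real.log_mul (by simp [hψ x hx, hψ y hy]) (by simp [hφ x hx, hφ y hy])]
    rw [← inv_div (S.val j x), Real.log_inv] at hj
    linarith
  · obtain ⟨i, j, hij⟩ :=
      exists_spread_eq fun i => Real.log (S.val i x) - Real.log (S.val i y)
    refine le_iSup₂_of_le (S.form j) (fun z hz => (S.val_pos j hz).ne')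
      (le_iSup₂_of_le (S.form i) (fun z hz => (S.val_pos i hz).ne') (ENNReal.ofReal_le_ofReal ?_))
    rw [hij, hlog, hlog]
    change _ ≤ Real.log |(S.val i x / S.val i y) * (S.val j y / S.val j x)|
    have h1 := div_pos (S.val_pos i hx) (S.val_pos i hy)
    have h2 := div_pos (S.val_pos j hy) (S.val_pos j hx)
    rw [abs_of_pos (mul_pos h1 h2), Real.log_mul h1.ne' h2.ne', ← inv_div (S.val j x), Real.log_inv]
    linarith

end SupportingSystem

/-! ### The tropical image of a polytope -/

namespace SupportingSystem

variable {n : ℕ} {P : Set (Chart n)} {ι : Type*} [Fintype ι]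

/-- The zero set of the `i`-th supporting form in the affine chart. -/
def zeros (S : SupportingSystem P ι) (i : ι) : Set (Chart n) := {x | S.val i x = 0}

/-- The tropical image of `P`: the families `τ` of exponents, normalized by `τ top = 0`, such that
every sublevel set `{i | τ i < c}` is the set of all the supporting forms vanishing on some subset of
`P`. For `c ≤ 0` that subset is nonempty because the form with index `top` does not vanish on it;
for `c > 0` it is empty, so that all the exponents are nonpositive. -/
def tropicalSet (S : SupportingSystem P ι) : Set (ι → ℝ) :=
  {τ | τ S.top = 0 ∧ ∀ c : ℝ, ∃ A ⊆ P, ∀ i, A ⊆ S.zeros i ↔ τ i < c}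

/-- The set of the points of `P` where all the supporting forms with exponent less than `c` vanish.
-/
def levelFace (S : SupportingSystem P ι) (τ : ι → ℝ) (c : ℝ) : Set (Chart n) :=
  {x | x ∈ P ∧ ∀ i, τ i < c → S.val i x = 0}

theorem levelFace_subset (S : SupportingSystem P ι) (τ : ι → ℝ) (c : ℝ) : S.levelFace τ c ⊆ P :=
  fun _ hx => hx.1

theorem levelFace_anti (S : SupportingSystem P ι) (τ : ι → ℝ) {c c' : ℝ} (h : c ≤ c') :
    S.levelFace τ c' ⊆ S.levelFace τ c :=
  fun _ hx => ⟨hx.1, fun i hi => hx.2 i (hi.trans_le h)⟩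

theorem not_subset_zeros_top (S : SupportingSystem P ι) {A : Set (Chart n)} (hA : A.Nonempty) :
    ¬ A ⊆ S.zeros S.top := by
  obtain ⟨x, hx⟩ := hA
  intro h
  have : S.val S.top x = 0 := h hx
  rw [val_top] at this
  exact one_ne_zero this

theorem levelFace_subset_zeros_iff {S : SupportingSystem P ι} {τ : ι → ℝ} (hτ : τ ∈ S.tropicalSet)
    (c : ℝ) (i : ι) : S.levelFace τ c ⊆ S.zeros i ↔ τ i < c := by
  refine ⟨fun h => ?_, fun h x hx => hx.2 i h⟩
  obtain ⟨A, hA, hAi⟩ := hτ.2 c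
  exact (hAi i).1 fun x hx => h ⟨hA hx, fun j hj => (hAi j).2 hj hx⟩

theorem levelFace_nonempty {S : SupportingSystem P ι} {τ : ι → ℝ} (hτ : τ ∈ S.tropicalSet)
    {c : ℝ} (hc : c ≤ 0) : (S.levelFace τ c).Nonempty := by
  by_contra h
  rw [Set.not_nonempty_iff_eq_empty] at h
  have h1 := (levelFace_subset_zeros_iff hτ c S.top).1 (by rw [h]; exact Set.empty_subset _)
  rw [hτ.1] at h1
  linarith

theorem tropicalSet_nonpos {S : SupportingSystem P ι} {τ : ι → ℝ} (hτ : τ ∈ S.tropicalSet)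
    (i : ι) : τ i ≤ 0 := by
  refine le_of_forall_gt fun c hc => (levelFace_subset_zeros_iff hτ c i).1 fun x hx => ?_
  have := hx.2 S.top (by rwa [hτ.1])
  rw [val_top] at this
  exact absurd this one_ne_zero

theorem convex_levelFace (S : SupportingSystem P ι) (hP : Convex ℝ P) (τ : ι → ℝ) (c : ℝ) :
    Convex ℝ (S.levelFace τ c) := by
  intro x hx y hy a b ha hb hab
  refine ⟨hP hx.1 hy.1 ha hb hab, fun i hi => ?_⟩
  have h := S.val_sum i Finset.univ ![a, b] (by simpa using hab) ![x, y]
  simpa [hx.2 i hi, hy.2 i hi] using h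

/-- A convex subset of `P` contains a point at which all the supporting forms not vanishing on the
subset are positive. -/
theorem exists_generic_point (S : SupportingSystem P ι) {A : Set (Chart n)} (hAP : A ⊆ P)
    (hA : Convex ℝ A) (hne : A.Nonempty) :
    ∃ b ∈ A, ∀ i, ¬ A ⊆ S.zeros i → 0 < S.val i b := by
  have hex : ∀ i, ∃ p ∈ A, ¬ A ⊆ S.zeros i → 0 < S.val i p := by
    intro i
    by_cases h : A ⊆ S.zeros i
    · exact ⟨hne.some, hne.some_mem, fun h' => absurd h h'⟩
    · obtain ⟨p, hp, hp0⟩ := Set.not_subset.1 h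
      exact ⟨p, hp, fun _ => (S.val_nonneg i (hAP hp)).lt_of_ne' hp0⟩
  choose p hpA hp using hex
  have : Nonempty ι := ⟨S.top⟩
  have hcard : (0 : ℝ) < Fintype.card ι := by exact_mod_cast Fintype.card_pos
  have hw : ∑ _j : ι, (Fintype.card ι : ℝ)⁻¹ = 1 := by
    simp [hcard.ne']
  refine ⟨∑ j, (Fintype.card ι : ℝ)⁻¹ • p j,
    hA.sum_mem (fun _ _ => by positivity) hw fun j _ => hpA j, fun i hi => ?_⟩
  rw [S.val_sum i _ _ hw]
  exact Finset.sum_pos' (fun j _ => mul_nonneg (by positivity) (S.val_nonneg i (hAP (hpA j))))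
    ⟨i, Finset.mem_univ i, mul_pos (by positivity) (hp i hi)⟩

end SupportingSystem

/-! ### Logarithmic limits of sequences in the polytope -/

theorem Ultrafilter.tendsto_atTop_of_ne_pure {ω : Ultrafilter ℕ} (hω : ∀ k : ℕ, ω ≠ pure k)
    {lam : ℕ → ℝ} (hlam : IsScalingSequence lam) : Filter.Tendsto lam ω Filter.atTop := by
  refine hlam.2.mono_left ?_
  rw [← Nat.cofinite_eq_atTop]
  rcases ω.le_cofinite_or_eq_pure with h | ⟨k, hk⟩
  · exact h
  · exact absurd hk (hω k)

section LogLimit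

variable {ω : Ultrafilter ℕ} {lam : ℕ → ℝ}

theorem tendsto_log_mul_exp_div (hlim : Filter.Tendsto lam ω Filter.atTop) {a : ℝ} (ha : 0 < a)
    (c : ℝ) : Filter.Tendsto (fun k => Real.log (a * Real.exp (lam k * c)) / lam k) ω (nhds c) := by
  have h1 : Filter.Tendsto (fun k => Real.log a / lam k + c) ω (nhds (0 + c)) :=
    (hlim.const_div_atTop _).add_const c
  rw [zero_add] at h1
  refine h1.congr' ?_
  filter_upwards [hlim.eventually_gt_atTop 0] with k hk
  rw [Real.log_mul ha.ne' (Real.exp_pos _).ne', Real.log_exp, add_div,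
    mul_div_cancel_left₀ _ hk.ne']

theorem le_of_tendsto_log_div (hlim : Filter.Tendsto lam ω Filter.atTop) {u : ℕ → ℝ} {t a c : ℝ}
    (hu : Filter.Tendsto (fun k => Real.log (u k) / lam k) ω (nhds t)) (ha : 0 < a)
    (h : ∀ᶠ k in ω, a * Real.exp (lam k * c) ≤ u k) : c ≤ t := by
  refine le_of_tendsto_of_tendsto (tendsto_log_mul_exp_div hlim ha c) hu ?_
  filter_upwards [h, hlim.eventually_gt_atTop 0] with k hk hk0
  exact div_le_div_of_nonneg_right (Real.log_le_log (mul_pos ha (Real.exp_pos _)) hk) hk0.le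

theorem ge_of_tendsto_log_div (hlim : Filter.Tendsto lam ω Filter.atTop) {u : ℕ → ℝ} {t a c : ℝ}
    (hu : Filter.Tendsto (fun k => Real.log (u k) / lam k) ω (nhds t)) (hpos : ∀ k, 0 < u k)
    (ha : 0 < a) (h : ∀ᶠ k in ω, u k ≤ a * Real.exp (lam k * c)) : t ≤ c := by
  refine le_of_tendsto_of_tendsto hu (tendsto_log_mul_exp_div hlim ha c) ?_
  filter_upwards [h, hlim.eventually_gt_atTop 0] with k hk hk0
  exact div_le_div_of_nonneg_right (Real.log_le_log (hpos k) hk) hk0.le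

namespace SupportingSystem

variable {n : ℕ} {P : Set (Chart n)} {ι : Type*} [Fintype ι]

/-- `τ i` is the `ω`-limit of `log (u_i (x_k)) / λ_k`, for every supporting form `u_i`. -/
def IsLogLimit (S : SupportingSystem P ι) (ω : Ultrafilter ℕ) (lam : ℕ → ℝ)
    (x : ℕ → HilbertGeometry (interior P)) (τ : ι → ℝ) : Prop :=
  ∀ i, Filter.Tendsto (fun k => Real.log (S.val i (x k).val) / lam k) ω (nhds (τ i))

theorem isLogLimit_const (S : SupportingSystem P ι) (hlim : Filter.Tendsto lam ω Filter.atTop)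
    (x : HilbertGeometry (interior P)) : S.IsLogLimit ω lam (fun _ => x) 0 :=
  fun _ => hlim.const_div_atTop _

theorem edist_eq (S : SupportingSystem P ι) (hP : IsPolytope P)
    (x y : HilbertGeometry (interior P)) :
    edist x y = ENNReal.ofReal
      (spread fun i => Real.log (S.val i x.val) - Real.log (S.val i y.val)) :=
  S.hilbertEDist_eq hP x.property y.property

theorem IsLogLimit.tendsto_edist {S : SupportingSystem P ι} (hP : IsPolytope P)
    (hlim : Filter.Tendsto lam ω Filter.atTop) {x y : ℕ → HilbertGeometry (interior P)}
    {σ τ : ι → ℝ} (hx : S.IsLogLimit ω lam x σ) (hy : S.IsLogLimit ω lam y τ) :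
    Filter.Tendsto (fun k => edist (x k) (y k) / ENNReal.ofReal (lam k)) ω
      (nhds (ENNReal.ofReal (spread (σ - τ)))) := by
  have : Nonempty ι := ⟨S.top⟩
  have h1 : Filter.Tendsto (fun k i => Real.log (S.val i (x k).val) / lam k -
      Real.log (S.val i (y k).val) / lam k) ω (nhds (σ - τ)) :=
    tendsto_pi_nhds.2 fun i => (hx i).sub (hy i)
  refine (ENNReal.tendsto_ofReal ((continuous_spread.tendsto _).comp h1)).congr' ?_
  filter_upwards [hlim.eventually_gt_atTop 0] with k hk
  rw [S.edist_eq hP, ← ENNReal.ofReal_div_of_pos hk, div_eq_inv_mul,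
    ← spread_smul (inv_nonneg.2 hk.le)]
  refine congrArg (fun a : ι → ℝ => ENNReal.ofReal (spread a)) (funext fun i => ?_)
  simp only [Pi.smul_apply, smul_eq_mul]
  ring

theorem IsLogLimit.ultraEDist_eq {S : SupportingSystem P ι} (hP : IsPolytope P)
    (hlim : Filter.Tendsto lam ω Filter.atTop) {x y : ℕ → HilbertGeometry (interior P)}
    {σ τ : ι → ℝ} (hx : S.IsLogLimit ω lam x σ) (hy : S.IsLogLimit ω lam y τ) :
    ultraEDist ω lam x y = ENNReal.ofReal (spread (σ - τ)) :=
  tendsto_nhds_unique (tendsto_ultraEDist ω lam x y) (hx.tendsto_edist hP hlim hy)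

theorem exists_isLogLimit (S : SupportingSystem P ι) (hP : IsPolytope P)
    (hlam : IsScalingSequence lam) {x₀ : HilbertGeometry (interior P)}
    {x : ℕ → HilbertGeometry (interior P)} (hx : ultraEDist ω lam (fun _ => x₀) x < ⊤) :
    ∃ τ, S.IsLogLimit ω lam x τ := by
  obtain ⟨C, hC, hC'⟩ := exists_between hx
  lift C to NNReal using hC'.ne
  have hev := (tendsto_ultraEDist ω lam (fun _ => x₀) x).eventually (gt_mem_nhds hC)
  have hlim : ∀ i, ∃ t, Filter.Tendsto (fun k => Real.log (S.val i (x k).val) / lam k) ω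
      (nhds t) := by
    intro i
    set M := |Real.log (S.val i x₀.val)| + C with hM
    have hmem : ∀ᶠ k in ω, Real.log (S.val i (x k).val) / lam k ∈ Set.Icc (-M) M := by
      filter_upwards [hev] with k hk
      have hlk := hlam.1 k
      have hpos : 0 < lam k := by linarith
      rw [S.edist_eq hP, ← ENNReal.ofReal_div_of_pos hpos,
        ENNReal.ofReal_lt_iff_lt_toReal (div_nonneg (spread_nonneg _) hpos.le) ENNReal.coe_ne_top,
        ENNReal.coe_toReal, div_lt_iff₀ hpos] at hk
      have h2 := (abs_sub_le_spread (fun i => Real.log (S.val i x₀.val) -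
        Real.log (S.val i (x k).val)) i S.top).trans hk.le
      simp only [val_top, Real.log_one, sub_zero] at h2
      rw [Set.mem_Icc, ← abs_le, abs_div, abs_of_pos hpos, div_le_iff₀ hpos, hM, add_mul]
      have h3 : |Real.log (S.val i (x k).val)| ≤ |Real.log (S.val i x₀.val)| +
          |Real.log (S.val i x₀.val) - Real.log (S.val i (x k).val)| := by
        rw [abs_sub_comm]
        linarith [abs_sub_abs_le_abs_sub (Real.log (S.val i (x k).val))
          (Real.log (S.val i x₀.val))]
      nlinarith [abs_nonneg (Real.log (S.val i x₀.val))]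
    obtain ⟨t, -, ht⟩ := isCompact_Icc.ultrafilter_le_nhds
      (ω.map fun k => Real.log (S.val i (x k).val) / lam k)
      (Filter.le_principal_iff.2 hmem)
    exact ⟨t, ht⟩
  choose τ hτ using hlim
  exact ⟨τ, hτ⟩

/-- Logarithmic limits lie in the tropical image: the subset of `P` attached to a level `c` consists
of the generating points whose weights in `x_k` are at least `exp (λ_k c')` for all `c' < c`. -/
theorem IsLogLimit.mem_tropicalSet {S : SupportingSystem P ι} (hP : IsPolytope P)
    (hlim : Filter.Tendsto lam ω Filter.atTop) {x : ℕ → HilbertGeometry (interior P)} {τ : ι → ℝ}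
    (hx : S.IsLogLimit ω lam x τ) : τ ∈ S.tropicalSet := by
  refine ⟨?_, fun c => ?_⟩
  · refine tendsto_nhds_unique (hx S.top) ?_
    simp [val_top]
  obtain ⟨s, hs, hPs⟩ := hP
  have hw : ∀ k, ∃ w : Chart n → ℝ, (∀ v ∈ hs.toFinset, 0 ≤ w v) ∧ ∑ v ∈ hs.toFinset, w v = 1 ∧
      ∑ v ∈ hs.toFinset, w v • v = (x k).val := by
    intro k
    have hmem : (x k).val ∈ convexHull ℝ s := hPs ▸ interior_subset (x k).property
    rwa [← hs.coe_toFinset, Finset.mem_convexHull'] at hmem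
  choose w hw0 hw1 hwx using hw
  have hsP : s ⊆ P := hPs ▸ subset_convexHull ℝ s
  have hval : ∀ i k, S.val i (x k).val = ∑ v ∈ hs.toFinset, w k v * S.val i v := fun i k => by
    rw [← hwx k]
    exact S.val_sum i _ _ (hw1 k) id
  have hnn : ∀ i, ∀ v ∈ hs.toFinset, 0 ≤ S.val i v := fun i v hv =>
    S.val_nonneg i (hsP (hs.mem_toFinset.1 hv))
  refine ⟨{v | v ∈ s ∧ ∀ c' < c, ∀ᶠ k in ω, Real.exp (lam k * c') ≤ w k v},
    fun v hv => hsP hv.1, fun i => ⟨fun h => ?_, fun h v hv => ?_⟩⟩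
  · -- each generating point off the zero set has a small weight, with a common gap below `c`
    have hsmall : ∀ v ∈ hs.toFinset, ∀ᶠ c' in nhdsWithin c (Set.Iio c),
        ∀ᶠ k in ω, w k v * S.val i v ≤ Real.exp (lam k * c') * S.val i v := by
      intro v hv
      by_cases hvi : S.val i v = 0
      · simp [hvi]
      · have hv' : ¬ ∀ c' < c, ∀ᶠ k in ω, Real.exp (lam k * c') ≤ w k v := fun h' =>
          hvi (h ⟨hs.mem_toFinset.1 hv, h'⟩)
        push Not at hv'
        obtain ⟨c₁, hc₁, hk⟩ := hv'
        filter_upwards [Ioo_mem_nhdsLT hc₁] with c' hc'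
        filter_upwards [hk, hlim.eventually_gt_atTop 0] with k hk hk0
        refine mul_le_mul_of_nonneg_right (hk.le.trans ?_) (hnn i v hv)
        exact Real.exp_le_exp.2 (mul_le_mul_of_nonneg_left hc'.1.le hk0.le)
    obtain ⟨c', hc', hlt⟩ := (((Filter.eventually_all_finset _).2 hsmall).and
      self_mem_nhdsWithin).exists
    refine lt_of_le_of_lt ?_ hlt
    have hMpos : 0 < ∑ v ∈ hs.toFinset, S.val i v + 1 := by
      have := Finset.sum_nonneg (hnn i)
      linarith
    refine ge_of_tendsto_log_div hlim (hx i) (fun k => S.val_pos i (x k).property) hMpos ?_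
    filter_upwards [(Filter.eventually_all_finset _).2 hc'] with k hk
    rw [hval, add_mul, Finset.sum_mul]
    refine (Finset.sum_le_sum hk).trans ?_
    simp only [mul_comm (Real.exp _)]
    have := Real.exp_pos (lam k * c')
    linarith
  · by_contra hvi
    have hpos : 0 < S.val i v := (S.val_nonneg i (hsP hv.1)).lt_of_ne' hvi
    refine absurd h (not_lt.2 (le_of_forall_lt fun c' hc' => ?_))
    obtain ⟨c'', h1, h2⟩ := exists_between hc'
    refine h1.trans_le (le_of_tendsto_log_div hlim (hx i) hpos ?_)
    filter_upwards [hv.2 c'' h2] with k hk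
    rw [hval, mul_comm]
    exact (mul_le_mul_of_nonneg_right hk hpos.le).trans
      (Finset.single_le_sum (f := fun v => w k v * S.val i v)
        (fun v hv => mul_nonneg (hw0 k v hv) (hnn i v hv)) (hs.mem_toFinset.2 hv.1))

/-- Every point of the tropical image is a logarithmic limit, namely that of the barycenters of
generic points of the level faces with weights proportional to `exp (λ_k τ_j)`. -/
theorem exists_isLogLimit_eq (S : SupportingSystem P ι) (hP : IsPolytope P)
    (hlim : Filter.Tendsto lam ω Filter.atTop) (hlam : ∀ k, 1 ≤ lam k) {τ : ι → ℝ}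
    (hτ : τ ∈ S.tropicalSet) : ∃ x, S.IsLogLimit ω lam x τ := by
  have hnonpos := tropicalSet_nonpos hτ
  choose b hbmem hb using fun j => S.exists_generic_point (S.levelFace_subset τ (τ j))
    (S.convex_levelFace hP.convex τ (τ j)) (levelFace_nonempty hτ (hnonpos j))
  -- `u_i` is positive at `b j` exactly when `τ j ≤ τ i`, so it decays with exponent `τ i`
  have hbP : ∀ j, b j ∈ P := fun j => (hbmem j).1
  have hb' : ∀ i j, τ j ≤ τ i → 0 < S.val i (b j) := fun i j hij =>
    hb j i fun h => absurd ((levelFace_subset_zeros_iff hτ _ _).1 h) (not_lt.2 hij)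
  set Z : ℕ → ℝ := fun k => ∑ j, Real.exp (lam k * τ j) with hZ
  have hZ1 : ∀ k, 1 ≤ Z k := fun k => by
    have := Finset.single_le_sum (f := fun j => Real.exp (lam k * τ j))
      (fun j _ => (Real.exp_pos _).le) (Finset.mem_univ S.top)
    simpa [hτ.1] using this
  have hZpos : ∀ k, 0 < Z k := fun k => zero_lt_one.trans_le (hZ1 k)
  have hZc : ∀ k, Z k ≤ Fintype.card ι := fun k => by
    have : Z k ≤ ∑ _j : ι, (1 : ℝ) := Finset.sum_le_sum fun j _ => by
      rw [Real.exp_le_one_iff]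
      exact mul_nonpos_of_nonneg_of_nonpos (by linarith [hlam k]) (hnonpos j)
    simpa using this
  set w : ℕ → ι → ℝ := fun k j => Real.exp (lam k * τ j) / Z k with hw
  have hwpos : ∀ k j, 0 < w k j := fun k j => div_pos (Real.exp_pos _) (hZpos k)
  have hw1 : ∀ k, ∑ j, w k j = 1 := fun k => by
    simp only [hw, ← Finset.sum_div]
    exact div_self (hZpos k).ne'
  set y : ℕ → Chart n := fun k => ∑ j, w k j • b j with hy
  have hval : ∀ i k, S.val i (y k) = ∑ j, w k j * S.val i (b j) := fun i k =>
    S.val_sum i _ _ (hw1 k) b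
  have hterm : ∀ i k j, 0 ≤ w k j * S.val i (b j) := fun i k j =>
    mul_nonneg (hwpos k j).le (S.val_nonneg i (hbP j))
  have hlow : ∀ i k, w k i * S.val i (b i) ≤ S.val i (y k) := fun i k => by
    rw [hval]
    exact Finset.single_le_sum (f := fun j => w k j * S.val i (b j))
      (fun j _ => hterm i k j) (Finset.mem_univ i)
  have hpos : ∀ i k, 0 < S.val i (y k) := fun i k =>
    (mul_pos (hwpos k i) (hb' i i le_rfl)).trans_le (hlow i k)
  have hcard : (0 : ℝ) < Fintype.card ι := by
    have : Nonempty ι := ⟨S.top⟩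
    exact_mod_cast Fintype.card_pos
  refine ⟨fun k => ⟨y k, S.mem_interior_of_val_pos hP fun i => hpos i k⟩, fun i => ?_⟩
  have ha : 0 < S.val i (b i) / Fintype.card ι := div_pos (hb' i i le_rfl) hcard
  have hM : 0 < ∑ j, S.val i (b j) :=
    Finset.sum_pos' (fun j _ => S.val_nonneg i (hbP j)) ⟨i, Finset.mem_univ i, hb' i i le_rfl⟩
  refine tendsto_of_tendsto_of_tendsto_of_le_of_le (tendsto_log_mul_exp_div hlim ha (τ i))
    (tendsto_log_mul_exp_div hlim hM (τ i)) (fun k => ?_) fun k => ?_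
  · refine div_le_div_of_nonneg_right (Real.log_le_log (mul_pos ha (Real.exp_pos _)) ?_)
      (by linarith [hlam k])
    refine le_trans ?_ (hlow i k)
    rw [div_mul_eq_mul_div, mul_comm]
    simp only [hw]
    rw [div_mul_eq_mul_div]
    exact div_le_div_of_nonneg_left (mul_nonneg (Real.exp_pos _).le (hb' i i le_rfl).le)
      (hZpos k) (hZc k)
  · refine div_le_div_of_nonneg_right (Real.log_le_log (hpos i k) ?_) (by linarith [hlam k])
    simp only [hval, Finset.sum_mul]
    refine Finset.sum_le_sum fun j _ => ?_
    rcases le_or_gt (τ j) (τ i) with h | h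
    · rw [mul_comm]
      refine mul_le_mul_of_nonneg_left ?_ (S.val_nonneg i (hbP j))
      refine (div_le_self (Real.exp_pos _).le (hZ1 k)).trans (Real.exp_le_exp.2 ?_)
      exact mul_le_mul_of_nonneg_left h (by linarith [hlam k])
    · simp [(hbmem j).2 i h]

end SupportingSystem

end LogLimit

/-! ### Faces of a polytope in terms of supporting forms -/

theorem faceDim_le {n : ℕ} (σ : Set (Chart n)) : faceDim σ ≤ n := by
  have := Submodule.finrank_le (vectorSpan ℝ σ)
  rwa [finrank_euclideanSpace_fin] at this

/-- The dimension of a face, as an index of a coordinate of `ℝⁿ⁺¹`. -/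
def faceIndex {n : ℕ} (σ : Set (Chart n)) : Fin (n + 1) :=
  ⟨faceDim σ, Nat.lt_succ_of_le (faceDim_le σ)⟩

theorem faceIndex_mono {n : ℕ} {σ σ' : Set (Chart n)} (h : σ ⊆ σ') : faceIndex σ ≤ faceIndex σ' :=
  Fin.mk_le_mk.2 (Submodule.finrank_mono (vectorSpan_mono ℝ h))

theorem faceIndex_eq_last {n : ℕ} {P : Set (Chart n)} (hint : (interior P).Nonempty) :
    faceIndex P = Fin.last n := by
  have h : affineSpan ℝ P = ⊤ :=
    affineSpan_eq_top_of_nonempty_interior (hint.mono (interior_mono (subset_convexHull ℝ P)))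
  refine Fin.ext ?_
  change faceDim P = n
  rw [faceDim, ← direction_affineSpan, h, AffineSubspace.direction_top, finrank_top,
    finrank_euclideanSpace_fin]

theorem self_mem_faces {n : ℕ} {P : Set (Chart n)} (hP : P.Nonempty) : P ∈ faces P :=
  ⟨hP, IsExposed.refl P⟩

namespace SupportingSystem

variable {n : ℕ} {P : Set (Chart n)} {ι : Type*} [Fintype ι]

theorem not_subset_zeros (S : SupportingSystem P ι) (hint : (interior P).Nonempty) (i : ι) :
    ¬ P ⊆ S.zeros i := by
  obtain ⟨x, hx⟩ := hint
  exact fun h => (S.val_pos i hx).ne' (h (interior_subset hx))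

/-- A face is cut out of `P` by the supporting forms vanishing on it. -/
theorem mem_face_of_val_eq_zero (S : SupportingSystem P ι) {σ : Set (Chart n)} (hσ : σ ∈ faces P)
    {x : Chart n} (hx : x ∈ P) (h : ∀ i, σ ⊆ S.zeros i → S.val i x = 0) : x ∈ σ := by
  obtain ⟨⟨x₁, hx₁⟩, hexp⟩ := hσ
  obtain ⟨l, hl⟩ := hexp ⟨x₁, hx₁⟩
  have hx₁' := hx₁
  rw [hl] at hx₁'
  let ψ : Module.Dual ℝ (Chart n × ℝ) :=
    l x₁ • LinearMap.snd ℝ (Chart n) ℝ - l.toLinearMap ∘ₗ LinearMap.fst ℝ (Chart n) ℝ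
  have hψ : ∀ y, ψ (y, 1) = l x₁ - l y := fun y => by simp [ψ]
  obtain ⟨c, hc, hsum⟩ := S.generates ψ fun y hy => by
    rw [hψ]; linarith [hx₁'.2 y hy]
  have hval : ∀ y, ψ (y, 1) = ∑ i, c i * S.val i y := fun y => by
    rw [hsum, LinearMap.sum_apply]; rfl
  have hzero : ∀ i, c i ≠ 0 → σ ⊆ S.zeros i := by
    intro i hi y hy
    rw [hl] at hy
    have h0 : ∑ j, c j * S.val j y = 0 := by
      rw [← hval, hψ]; linarith [hx₁'.2 y hy.1, hy.2 x₁ hx₁'.1]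
    have := (Finset.sum_eq_zero_iff_of_nonneg fun j _ =>
      mul_nonneg (hc j) (S.val_nonneg j hy.1)).1 h0 i (Finset.mem_univ i)
    exact (mul_eq_zero.1 this).resolve_left hi
  have hψx : ψ (x, 1) = 0 := by
    rw [hval]
    refine Finset.sum_eq_zero fun i _ => ?_
    by_cases hi : c i = 0
    · rw [hi, zero_mul]
    · rw [h i (hzero i hi), mul_zero]
  rw [hψ] at hψx
  rw [hl]
  exact ⟨hx, fun y hy => by linarith [hx₁'.2 y hy]⟩

/-- Level faces are faces: the sum of the forms that cut one out exposes it. -/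
theorem levelFace_mem_faces (S : SupportingSystem P ι) {τ : ι → ℝ} {c : ℝ}
    (hne : (S.levelFace τ c).Nonempty) : S.levelFace τ c ∈ faces P := by
  classical
  refine ⟨hne, fun _ => ?_⟩
  set ψ : Module.Dual ℝ (Chart n × ℝ) := ∑ i with τ i < c, S.form i with hψ
  let l : StrongDual ℝ (Chart n) :=
    LinearMap.toContinuousLinearMap (-(ψ ∘ₗ LinearMap.inl ℝ (Chart n) ℝ))
  have hval : ∀ y, ψ (y, 1) = ∑ i with τ i < c, S.val i y := fun y => by
    rw [hψ, LinearMap.sum_apply]; rfl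
  have hl : ∀ y, l y = ψ (0, 1) - ψ (y, 1) := by
    intro y
    rw [← map_sub]
    change -(ψ (y, 0)) = _
    rw [← map_neg]
    congr 1
    simp
  have hnn : ∀ y ∈ P, 0 ≤ ψ (y, 1) := fun y hy => by
    rw [hval]; exact Finset.sum_nonneg fun i _ => S.val_nonneg i hy
  have hzero : ∀ y ∈ P, y ∈ S.levelFace τ c ↔ ψ (y, 1) = 0 := by
    intro y hy
    rw [hval, Finset.sum_eq_zero_iff_of_nonneg fun i _ => S.val_nonneg i hy]
    simp [levelFace, hy]
  refine ⟨l, Set.ext fun x => ⟨fun hx => ⟨hx.1, fun y hy => ?_⟩, fun hx => ?_⟩⟩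
  · rw [hl, hl, (hzero x hx.1).1 hx]
    linarith [hnn y hy]
  · obtain ⟨z, hz⟩ := hne
    have h1 := hx.2 z hz.1
    rw [hl, hl, (hzero z hz.1).1 hz] at h1
    exact (hzero x hx.1).2 (le_antisymm (by linarith) (hnn x hx.1))

/-- Nested faces of the same dimension coincide. -/
theorem face_eq_of_faceIndex_le (S : SupportingSystem P ι) {σ σ' : Set (Chart n)}
    (hσ : σ ∈ faces P) (hσ' : σ' ∈ faces P) (h : σ ⊆ σ') (hdim : faceIndex σ' ≤ faceIndex σ) :
    σ = σ' := by
  refine h.antisymm fun y hy => S.mem_face_of_val_eq_zero hσ (hσ'.2.subset hy) fun i hi => ?_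
  obtain ⟨x, hx⟩ := hσ.1
  have hspan : vectorSpan ℝ σ = vectorSpan ℝ σ' :=
    Submodule.eq_of_le_of_finrank_le (vectorSpan_mono ℝ h) hdim
  have hmem : y - x ∈ vectorSpan ℝ σ := hspan ▸ vsub_mem_vectorSpan ℝ hy (h hx)
  have hker : vectorSpan ℝ σ ≤ LinearMap.ker (S.form i ∘ₗ LinearMap.inl ℝ (Chart n) ℝ) := by
    refine Submodule.span_le.2 ?_
    rintro _ ⟨p, hp, q, hq, rfl⟩
    have h1 : S.form i (p, 1) = 0 := hi hp
    have h2 : S.form i (q, 1) = 0 := hi hq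
    change S.form i (p - q, 0) = 0
    rw [show ((p - q, 0) : Chart n × ℝ) = (p, 1) - (q, 1) by simp, map_sub, h1, h2, sub_zero]
  have h0 : S.form i (y - x, 0) = 0 := hker hmem
  have h1 : S.form i (x, 1) = 0 := hi hx
  change S.form i (y, 1) = 0
  rw [show ((y, 1) : Chart n × ℝ) = (y - x, 0) + (x, 1) by simp, map_add, h0, h1, add_zero]

theorem finite_faces (S : SupportingSystem P ι) : (faces P).Finite := by
  refine Set.Finite.of_injOn (f := fun σ => {i | σ ⊆ S.zeros i}) (Set.mapsTo_univ _ _) ?_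
    Set.finite_univ
  have key : ∀ σ ∈ faces P, ∀ σ' ∈ faces P, {i | σ ⊆ S.zeros i} = {i | σ' ⊆ S.zeros i} →
      σ ⊆ σ' := fun σ hσ σ' hσ' h x hx =>
    S.mem_face_of_val_eq_zero hσ' (hσ.2.subset hx) fun i hi =>
      (show i ∈ {i | σ ⊆ S.zeros i} by rw [h]; exact hi) hx
  exact fun σ hσ σ' hσ' h => (key σ hσ σ' hσ' h).antisymm (key σ' hσ' σ hσ h.symm)

theorem finite_pointedFlag (S : SupportingSystem P ι) : Finite (PointedFlag P) :=
  have := S.finite_faces.finite_subsets.to_subtype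
  Finite.of_injective (β := {a | a ⊆ faces P}) (fun F => ⟨F.members, F.members_subset⟩)
    fun _ _ h => PointedFlag.ext (Subtype.ext_iff.1 h)

end SupportingSystem

/-! ### Coordinates on the model flat -/

namespace ModelFlat

variable {n : ℕ}

/-- The coordinates of a point of the model flat, normalized by the vanishing of the first one. -/
def coord : ModelFlat n →ₗ[ℝ] (Fin (n + 1) → ℝ) :=
  Submodule.liftQ (Submodule.span ℝ {(1 : Fin (n + 1) → ℝ)})
    { toFun := fun (α : Fin (n + 1) → ℝ) i => α i - α 0
      map_add' := fun α β => funext fun i => by simp only [Pi.add_apply]; ring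
      map_smul' := fun r α => funext fun i => by
        simp only [Pi.smul_apply, smul_eq_mul, RingHom.id_apply]; ring }
    (by
      rw [Submodule.span_le, Set.singleton_subset_iff]
      exact LinearMap.mem_ker.2 (funext fun _ => sub_self (1 : ℝ)))

theorem coord_mk (α : Fin (n + 1) → ℝ) (i : Fin (n + 1)) :
    coord (Submodule.Quotient.mk α : ModelFlat n) i = α i - α 0 := rfl

theorem coord_apply_zero (a : ModelFlat n) : coord a 0 = 0 := by
  induction a using Submodule.Quotient.induction_on with | _ α
  rw [coord_mk, sub_self]

theorem coord_mk_of_zero {α : Fin (n + 1) → ℝ} (h : α 0 = 0) :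
    coord (Submodule.Quotient.mk α : ModelFlat n) = α :=
  funext fun i => by rw [coord_mk, h, sub_zero]

theorem mk_coord (a : ModelFlat n) : Submodule.Quotient.mk (coord a) = a := by
  induction a using Submodule.Quotient.induction_on with | _ α
  rw [Submodule.Quotient.eq, Submodule.mem_span_singleton]
  exact ⟨-α 0, funext fun i => by simp [coord_mk]⟩

theorem coord_injective : Function.Injective (coord : ModelFlat n → Fin (n + 1) → ℝ) :=
  Function.LeftInverse.injective mk_coord

theorem hexNorm_eq_spread (a : ModelFlat n) : hexNorm a = spread (coord a) := by
  conv_lhs => rw [← mk_coord a]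
  rfl

theorem mem_chamberFace_iff {D : Set (Fin n)} {a : ModelFlat n} :
    a ∈ chamberFace D ↔ (∀ i : Fin n, coord a i.succ ≤ coord a i.castSucc) ∧
      ∀ i : Fin n, i ∉ D → coord a i.castSucc = coord a i.succ := by
  constructor
  · rintro ⟨α, rfl, h1, h2⟩
    exact ⟨fun i => sub_le_sub_right (h1 i) (α 0), fun i hi => by rw [coord_mk, coord_mk, h2 i hi]⟩
  · rintro ⟨h1, h2⟩
    exact ⟨coord a, mk_coord a, h1, h2⟩

theorem antitone_coord {D : Set (Fin n)} {a : ModelFlat n} (ha : a ∈ chamberFace D) :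
    Antitone (coord a) :=
  Fin.antitone_iff_succ_le.2 (mem_chamberFace_iff.1 ha).1

theorem coord_nonpos {D : Set (Fin n)} {a : ModelFlat n} (ha : a ∈ chamberFace D)
    (i : Fin (n + 1)) : coord a i ≤ 0 := by
  rw [← coord_apply_zero a]
  exact antitone_coord ha (Fin.zero_le i)

/-- The coordinates of a point of a chamber face are constant between the allowed jumps. -/
theorem coord_eq_of_no_jump {D : Set (Fin n)} {a : ModelFlat n} (ha : a ∈ chamberFace D)
    {i j : Fin (n + 1)} (hij : i ≤ j)
    (h : ∀ k : Fin n, k ∈ D → i ≤ k.castSucc → j ≤ k.castSucc) : coord a i = coord a j := by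
  induction j using Fin.induction with
  | zero => rw [le_antisymm hij (Fin.zero_le i)]
  | succ k ih =>
    rcases hij.eq_or_lt with rfl | hlt
    · rfl
    · have hik : i ≤ k.castSucc := Fin.le_castSucc_iff.2 hlt
      have hk : k ∉ D := fun hk => absurd (h k hk hik) (not_le.2 Fin.castSucc_lt_succ)
      rw [ih hik fun k' hk' hik' => Fin.castSucc_lt_succ.le.trans (h k' hk' hik'),
        (mem_chamberFace_iff.1 ha).2 k hk]

end ModelFlat

/-! ### The flag realization and the tropical image -/

theorem eq_of_forall_nonpos_lt_iff {x y : ℝ} (hx : x ≤ 0) (hy : y ≤ 0)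
    (h : ∀ c ≤ (0 : ℝ), x < c ↔ y < c) : x = y := by
  rcases lt_trichotomy x y with hxy | hxy | hxy
  · exact absurd ((h y hy).1 hxy) (lt_irrefl y)
  · exact hxy
  · exact absurd ((h x hx).2 hxy) (lt_irrefl x)

namespace SupportingSystem

variable {n : ℕ} {P : Set (Chart n)} {ι : Type*} [Fintype ι]

theorem exists_cutFace (S : SupportingSystem P ι) (hint : (interior P).Nonempty)
    (F : PointedFlag P) (i : ι) :
    ∃ σ ∈ F.members, ¬ σ ⊆ S.zeros i ∧ ∀ σ' ∈ F.members, ¬ σ' ⊆ S.zeros i → σ ⊆ σ' := by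
  have hfin : {σ | σ ∈ F.members ∧ ¬ σ ⊆ S.zeros i}.Finite :=
    S.finite_faces.subset fun σ hσ => F.members_subset hσ.1
  obtain ⟨σ, hσ⟩ := hfin.exists_minimal ⟨P, F.mem_self, S.not_subset_zeros hint i⟩
  refine ⟨σ, hσ.prop.1, hσ.prop.2, fun σ' hσ' hi => ?_⟩
  rcases F.isChain.total hσ.prop.1 hσ' with h | h
  · exact h
  · exact hσ.le_of_le ⟨hσ', hi⟩ h

/-- The smallest member of a flag on which the `i`-th supporting form does not vanish. -/
def cutFace (S : SupportingSystem P ι) (hint : (interior P).Nonempty) (F : PointedFlag P) (i : ι) :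
    Set (Chart n) := (S.exists_cutFace hint F i).choose

theorem cutFace_mem (S : SupportingSystem P ι) (hint : (interior P).Nonempty) (F : PointedFlag P)
    (i : ι) : S.cutFace hint F i ∈ F.members := (S.exists_cutFace hint F i).choose_spec.1

theorem cutFace_not_subset (S : SupportingSystem P ι) (hint : (interior P).Nonempty)
    (F : PointedFlag P) (i : ι) : ¬ S.cutFace hint F i ⊆ S.zeros i :=
  (S.exists_cutFace hint F i).choose_spec.2.1

theorem cutFace_subset (S : SupportingSystem P ι) (hint : (interior P).Nonempty)
    {F : PointedFlag P} {i : ι} {σ : Set (Chart n)} (hσ : σ ∈ F.members) (h : ¬ σ ⊆ S.zeros i) :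
    S.cutFace hint F i ⊆ σ :=
  (S.exists_cutFace hint F i).choose_spec.2.2 σ hσ h

/-- The exponents of the supporting forms at a point of a chamber face. The exponent of `u_i` is the
normalized coordinate indexed by the dimension of the smallest member of the flag on which `u_i` does
not vanish. -/
def exponent (S : SupportingSystem P ι) (hint : (interior P).Nonempty) (F : PointedFlag P)
    (a : ModelFlat n) (i : ι) : ℝ :=
  ModelFlat.coord a (faceIndex (S.cutFace hint F i))

theorem mem_flagType {F : PointedFlag P} {k : Fin n} (hint : (interior P).Nonempty) :
    k ∈ F.flagType ↔ ∃ σ ∈ F.members, faceIndex σ = k.castSucc := by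
  constructor
  · rintro ⟨σ, hσ, -, h⟩
    exact ⟨σ, hσ, Fin.ext h⟩
  · rintro ⟨σ, hσ, h⟩
    refine ⟨σ, hσ, ?_, congrArg Fin.val h⟩
    rintro rfl
    rw [faceIndex_eq_last hint] at h
    exact (Fin.castSucc_lt_last k).ne' h

/-- For every level `c ≤ 0`, the coordinates that are at least `c` are those up to the dimension of
some member of the flag. -/
theorem exists_member_le_coord_iff (hint : (interior P).Nonempty) {F : PointedFlag P}
    {a : ModelFlat n} (ha : a ∈ chamberFace F.flagType) {c : ℝ} (hc : c ≤ 0) :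
    ∃ σ ∈ F.members, ∀ j, c ≤ ModelFlat.coord a j ↔ j ≤ faceIndex σ := by
  have hanti := ModelFlat.antitone_coord ha
  obtain ⟨j, hj⟩ := (Set.toFinite {j | c ≤ ModelFlat.coord a j}).exists_maximal
    ⟨0, by rwa [Set.mem_ofPred, ModelFlat.coord_apply_zero]⟩
  have hiff : ∀ j', c ≤ ModelFlat.coord a j' ↔ j' ≤ j := fun j' => by
    refine ⟨fun h => ?_, fun h => hj.prop.trans (hanti h)⟩
    rcases le_total j' j with h' | h'
    · exact h'
    · exact hj.le_of_ge h h'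
  rcases Fin.eq_castSucc_or_eq_last j with ⟨k, rfl⟩ | rfl
  · have hk : k ∈ F.flagType := by
      by_contra hk
      have h1 := (ModelFlat.mem_chamberFace_iff.1 ha).2 k hk
      have h2 : c ≤ ModelFlat.coord a k.succ := h1 ▸ hj.prop
      exact absurd ((hiff _).1 h2) (not_le.2 Fin.castSucc_lt_succ)
    obtain ⟨σ, hσ, hσk⟩ := (mem_flagType hint).1 hk
    exact ⟨σ, hσ, fun j' => by rw [hσk, hiff]⟩
  · exact ⟨P, F.mem_self, fun j' => by rw [faceIndex_eq_last hint, hiff]⟩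

/-- The supporting forms with exponent less than `c` are those that vanish on the member of the flag
attached to the level `c`. -/
theorem subset_zeros_iff_exponent_lt (S : SupportingSystem P ι) (hint : (interior P).Nonempty)
    {F : PointedFlag P} {a : ModelFlat n} {c : ℝ} {σ : Set (Chart n)} (hσ : σ ∈ F.members)
    (h : ∀ j, c ≤ ModelFlat.coord a j ↔ j ≤ faceIndex σ) (i : ι) :
    σ ⊆ S.zeros i ↔ S.exponent hint F a i < c := by
  rw [exponent, ← not_le, h]
  constructor
  · intro hi hle
    have hmem := S.cutFace_mem hint F i
    have hnot := S.cutFace_not_subset hint F i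
    rcases F.isChain.total hσ hmem with hsub | hsub
    · have := S.face_eq_of_faceIndex_le (F.members_subset hσ) (F.members_subset hmem) hsub hle
      exact hnot (this ▸ hi)
    · exact hnot (hsub.trans hi)
  · intro hle
    by_contra hi
    exact hle (faceIndex_mono (S.cutFace_subset hint hσ hi))

theorem levelFace_eq_of_subset_zeros_iff (S : SupportingSystem P ι) {τ : ι → ℝ} {c : ℝ}
    {σ : Set (Chart n)} (hσ : σ ∈ faces P) (h : ∀ i, σ ⊆ S.zeros i ↔ τ i < c) :
    S.levelFace τ c = σ :=
  Set.Subset.antisymm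
    (fun _ hx => S.mem_face_of_val_eq_zero hσ hx.1 fun i hi => hx.2 i ((h i).1 hi))
    fun _ hx => ⟨hσ.2.subset hx, fun i hi => (h i).2 hi hx⟩

theorem exponent_nonpos (S : SupportingSystem P ι) (hint : (interior P).Nonempty)
    {F : PointedFlag P} {a : ModelFlat n} (ha : a ∈ chamberFace F.flagType) (i : ι) :
    S.exponent hint F a i ≤ 0 :=
  ModelFlat.coord_nonpos ha _

/-- The level faces of the exponents of a point of a chamber face are members of the flag, and their
dimensions determine the coordinates of the point. -/
theorem levelFace_exponent (S : SupportingSystem P ι) (hint : (interior P).Nonempty)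
    {F : PointedFlag P} {a : ModelFlat n} (ha : a ∈ chamberFace F.flagType) {c : ℝ} (hc : c ≤ 0) :
    S.levelFace (S.exponent hint F a) c ∈ F.members ∧
      ∀ j, c ≤ ModelFlat.coord a j ↔ j ≤ faceIndex (S.levelFace (S.exponent hint F a) c) := by
  obtain ⟨σ, hσ, h⟩ := exists_member_le_coord_iff hint ha hc
  rw [S.levelFace_eq_of_subset_zeros_iff (F.members_subset hσ)
    (S.subset_zeros_iff_exponent_lt hint hσ h)]
  exact ⟨hσ, h⟩

theorem exponent_mem_tropicalSet (S : SupportingSystem P ι) (hint : (interior P).Nonempty)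
    {F : PointedFlag P} {a : ModelFlat n} (ha : a ∈ chamberFace F.flagType) :
    S.exponent hint F a ∈ S.tropicalSet := by
  constructor
  · refine le_antisymm (S.exponent_nonpos hint ha _) ?_
    obtain ⟨σ, hσ, h⟩ := exists_member_le_coord_iff hint ha le_rfl
    exact not_lt.1 fun hlt => S.not_subset_zeros_top (F.members_subset hσ).1
      ((S.subset_zeros_iff_exponent_lt hint hσ h _).2 hlt)
  · intro c
    rcases le_or_gt c 0 with hc | hc
    · obtain ⟨σ, hσ, h⟩ := exists_member_le_coord_iff hint ha hc
      exact ⟨σ, (F.members_subset hσ).2.subset, S.subset_zeros_iff_exponent_lt hint hσ h⟩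
    · exact ⟨∅, Set.empty_subset _, fun i => iff_of_true (Set.empty_subset _)
        ((S.exponent_nonpos hint ha i).trans_lt hc)⟩

/-- Exponents do not change when the flag is enlarged. -/
theorem exponent_eq_of_subset (S : SupportingSystem P ι) (hint : (interior P).Nonempty)
    {F F' : PointedFlag P} (hF : F.members ⊆ F'.members) {a : ModelFlat n}
    (ha : a ∈ chamberFace F.flagType) (ha' : a ∈ chamberFace F'.flagType) :
    S.exponent hint F a = S.exponent hint F' a := by
  funext i
  refine eq_of_forall_nonpos_lt_iff (S.exponent_nonpos hint ha i) (S.exponent_nonpos hint ha' i)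
    fun c hc => ?_
  obtain ⟨σ, hσ, h⟩ := exists_member_le_coord_iff hint ha hc
  rw [← S.subset_zeros_iff_exponent_lt hint hσ h, ← S.subset_zeros_iff_exponent_lt hint (hF hσ) h]

/-- The map from the flag realization to the tropical image. -/
def realizationExponent (S : SupportingSystem P ι) (hint : (interior P).Nonempty) :
    FlagRealization P → ι → ℝ :=
  Quot.lift (fun p : ChamberUnion P => S.exponent hint p.1 p.2) fun p q h => by
    have hq := q.2.2
    rw [← h.2] at hq
    change _ = S.exponent hint q.1 q.2
    rw [← h.2]
    exact S.exponent_eq_of_subset hint h.1 p.2.2 hq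

/-- The flag formed by the nonempty level faces of a point of the tropical image. -/
def levelFlag (S : SupportingSystem P ι) (hint : (interior P).Nonempty) {τ : ι → ℝ}
    (hτ : τ ∈ S.tropicalSet) : PointedFlag P where
  members := {σ | σ = P ∨ ∃ c ≤ (0 : ℝ), σ = S.levelFace τ c}
  members_subset := by
    rintro σ (rfl | ⟨c, hc, rfl⟩)
    · exact self_mem_faces (hint.mono interior_subset)
    · exact S.levelFace_mem_faces (levelFace_nonempty hτ hc)
  isChain := by
    rintro σ (rfl | ⟨c, hc, rfl⟩) σ' (rfl | ⟨c', hc', rfl⟩) -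
    · exact Or.inl subset_rfl
    · exact Or.inr (S.levelFace_subset τ c')
    · exact Or.inl (S.levelFace_subset τ c)
    · rcases le_total c c' with h | h
      · exact Or.inr (S.levelFace_anti τ h)
      · exact Or.inl (S.levelFace_anti τ h)
  mem_self := Or.inl rfl

theorem mem_chamberFace_levelFlag (S : SupportingSystem P ι) (hint : (interior P).Nonempty)
    {τ : ι → ℝ} (hτ : τ ∈ S.tropicalSet) {a : ModelFlat n} (hnonpos : ∀ j, ModelFlat.coord a j ≤ 0)
    (h : ∀ c ≤ (0 : ℝ), ∀ j, c ≤ ModelFlat.coord a j ↔ j ≤ faceIndex (S.levelFace τ c)) :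
    a ∈ chamberFace (S.levelFlag hint hτ).flagType := by
  have hmono : ∀ k : Fin n, ModelFlat.coord a k.succ ≤ ModelFlat.coord a k.castSucc := fun k =>
    (h _ (hnonpos _) _).2 (Fin.castSucc_lt_succ.le.trans ((h _ (hnonpos k.succ) _).1 le_rfl))
  refine ModelFlat.mem_chamberFace_iff.2 ⟨hmono, fun k hk => ?_⟩
  by_contra hne
  have hlt := (hmono k).lt_of_ne' hne
  refine hk ((mem_flagType hint).2
    ⟨S.levelFace τ (ModelFlat.coord a k.castSucc), Or.inr ⟨_, hnonpos _, rfl⟩, ?_⟩)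
  refine le_antisymm ?_ ((h _ (hnonpos _) _).1 le_rfl)
  rw [Fin.le_castSucc_iff, ← not_le, ← h _ (hnonpos _)]
  exact not_le.2 hlt

theorem realizationExponent_injective (S : SupportingSystem P ι) (hint : (interior P).Nonempty) :
    Function.Injective (S.realizationExponent hint) := by
  rintro ⟨F, a, ha⟩ ⟨F', a', ha'⟩ heq
  change S.exponent hint F a = S.exponent hint F' a' at heq
  have haa : a = a' := by
    refine ModelFlat.coord_injective (funext fun j => ?_)
    refine eq_of_forall_nonpos_lt_iff (ModelFlat.coord_nonpos ha j) (ModelFlat.coord_nonpos ha' j)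
      fun c hc => ?_
    rw [← not_le, ← not_le, (S.levelFace_exponent hint ha hc).2 j, heq,
      ← (S.levelFace_exponent hint ha' hc).2 j]
  subst haa
  have hτ := S.exponent_mem_tropicalSet hint ha
  have ha₀ := S.mem_chamberFace_levelFlag hint hτ (ModelFlat.coord_nonpos ha)
    fun c hc => (S.levelFace_exponent hint ha hc).2
  have hsub : (S.levelFlag hint hτ).members ⊆ F.members := by
    rintro σ (rfl | ⟨c, hc, rfl⟩)
    · exact F.mem_self
    · exact (S.levelFace_exponent hint ha hc).1
  have hsub' : (S.levelFlag hint hτ).members ⊆ F'.members := by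
    rintro σ (rfl | ⟨c, hc, rfl⟩)
    · exact F'.mem_self
    · rw [heq]
      exact (S.levelFace_exponent hint ha' hc).1
  exact (Quot.sound (show chamberGlue (⟨_, a, ha₀⟩ : ChamberUnion P) ⟨F, a, ha⟩ from
    ⟨hsub, rfl⟩)).symm.trans (Quot.sound ⟨hsub', rfl⟩)

/-- The largest level at which the level face has dimension at least `j`. -/
theorem exists_level_of_dim (S : SupportingSystem P ι) (hint : (interior P).Nonempty)
    {τ : ι → ℝ} (hτ : τ ∈ S.tropicalSet) (j : Fin (n + 1)) :
    ∃ β ≤ (0 : ℝ), ∀ c ≤ (0 : ℝ), c ≤ β ↔ j ≤ faceIndex (S.levelFace τ c) := by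
  classical
  obtain ⟨i₀, -, hi₀⟩ := Finset.exists_min_image Finset.univ τ ⟨S.top, Finset.mem_univ _⟩
  have hmin : S.levelFace τ (τ i₀) = P :=
    (S.levelFace_subset τ _).antisymm fun x hx =>
      ⟨hx, fun i hi => absurd hi (not_lt.2 (hi₀ i (Finset.mem_univ i)))⟩
  obtain ⟨i₁, hi₁, hmax⟩ := Finset.exists_max_image
    (Finset.univ.filter fun i => j ≤ faceIndex (S.levelFace τ (τ i))) τ
    ⟨i₀, by simp [hmin, faceIndex_eq_last hint, Fin.le_last]⟩
  rw [Finset.mem_filter] at hi₁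
  refine ⟨τ i₁, tropicalSet_nonpos hτ _, fun c hc => ⟨fun h => ?_, fun h => ?_⟩⟩
  · exact hi₁.2.trans (faceIndex_mono (S.levelFace_anti τ h))
  · -- the level face does not change between `c` and the next exponent above it
    obtain ⟨i₂, hi₂, hmin₂⟩ := Finset.exists_min_image (Finset.univ.filter fun i => c ≤ τ i) τ
      ⟨S.top, by simp [hτ.1, hc]⟩
    rw [Finset.mem_filter] at hi₂
    have hsub : S.levelFace τ c ⊆ S.levelFace τ (τ i₂) := fun x hx =>
      ⟨hx.1, fun i hi => hx.2 i (lt_of_not_ge fun hci =>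
        absurd hi (not_lt.2 (hmin₂ i (by simp [hci]))))⟩
    exact hi₂.2.trans (hmax i₂ (by simp [h.trans (faceIndex_mono hsub)]))

theorem range_realizationExponent (S : SupportingSystem P ι) (hint : (interior P).Nonempty) :
    Set.range (S.realizationExponent hint) = S.tropicalSet := by
  refine Set.Subset.antisymm ?_ fun τ hτ => ?_
  · rintro _ ⟨⟨F, a, ha⟩, rfl⟩
    exact S.exponent_mem_tropicalSet hint ha
  choose β hβ0 hβ using S.exists_level_of_dim hint hτ
  have hzero : β 0 = 0 := le_antisymm (hβ0 0) ((hβ 0 0 le_rfl).2 (Fin.zero_le _))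
  have hcoord : ModelFlat.coord (Submodule.Quotient.mk β : ModelFlat n) = β :=
    ModelFlat.coord_mk_of_zero hzero
  have hiff : ∀ c ≤ (0 : ℝ), ∀ j, c ≤ ModelFlat.coord (Submodule.Quotient.mk β : ModelFlat n) j ↔
      j ≤ faceIndex (S.levelFace τ c) := fun c hc j => by rw [hcoord, hβ j c hc]
  have ha := S.mem_chamberFace_levelFlag hint hτ (by rw [hcoord]; exact hβ0) hiff
  refine ⟨Quot.mk _ ⟨S.levelFlag hint hτ, _, ha⟩, funext fun i => ?_⟩
  refine eq_of_forall_nonpos_lt_iff (S.exponent_nonpos hint ha i) (tropicalSet_nonpos hτ i) fun c hc => ?_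
  rw [← levelFace_subset_zeros_iff hτ c i]
  exact (S.subset_zeros_iff_exponent_lt hint (Or.inr ⟨c, hc, rfl⟩) (hiff c hc) i).symm

/-! ### The metric of the flag realization -/

/-- Every coordinate of a chamber face is read off as the exponent of some supporting form, which
depends on the flag only. -/
theorem exists_exponent_eq_coord (S : SupportingSystem P ι) (hint : (interior P).Nonempty)
    (F : PointedFlag P) (j : Fin (n + 1)) :
    ∃ i, ∀ a ∈ chamberFace F.flagType, S.exponent hint F a i = ModelFlat.coord a j := by
  have hfin : F.members.Finite := S.finite_faces.subset F.members_subset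
  -- `σ` is the smallest member of dimension at least `j`
  obtain ⟨σ, hσ, hmin⟩ := (hfin.subset
    (Set.sep_subset F.members fun σ => j ≤ faceIndex σ)).exists_minimalFor faceIndex _
      ⟨P, F.mem_self, by rw [faceIndex_eq_last hint]; exact Fin.le_last j⟩
  have hmin' : ∀ ρ ∈ F.members, j ≤ faceIndex ρ → faceIndex σ ≤ faceIndex ρ := fun ρ hρ hj =>
    (le_total (faceIndex σ) (faceIndex ρ)).elim id fun h => hmin ⟨hρ, hj⟩ h
  have hex : ∃ i, ¬ σ ⊆ S.zeros i ∧ ∀ ρ ∈ F.members, ¬ ρ ⊆ S.zeros i → j ≤ faceIndex ρ := by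
    by_cases hlow : ∃ ρ ∈ F.members, faceIndex ρ < j
    · -- a form that vanishes on the largest member of smaller dimension but not on `σ`
      obtain ⟨ρ, hρ, hmax⟩ := (hfin.subset
        (Set.sep_subset F.members fun ρ => faceIndex ρ < j)).exists_maximal hlow
      have hnot : ¬ σ ⊆ ρ := fun h => absurd (hσ.2.trans (faceIndex_mono h)) (not_le.2 hρ.2)
      obtain ⟨i, hi, hi'⟩ : ∃ i, ρ ⊆ S.zeros i ∧ ¬ σ ⊆ S.zeros i := by
        by_contra! hcon
        exact hnot fun x hx => S.mem_face_of_val_eq_zero (F.members_subset hρ.1)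
          ((F.members_subset hσ.1).2.subset hx) fun i hi => hcon i hi hx
      refine ⟨i, hi', fun ρ' hρ' hnz => ?_⟩
      by_contra hlt
      rcases F.isChain.total hρ' hρ.1 with h | h
      · exact hnz (h.trans hi)
      · exact hnz ((hmax ⟨hρ', not_le.1 hlt⟩ h).trans hi)
    · push Not at hlow
      exact ⟨S.top, S.not_subset_zeros_top (F.members_subset hσ.1).1, fun ρ hρ _ => hlow ρ hρ⟩
  obtain ⟨i, hi, hi'⟩ := hex
  refine ⟨i, fun a ha => ?_⟩
  have hcut := hi' _ (S.cutFace_mem hint F i) (S.cutFace_not_subset hint F i)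
  refine (ModelFlat.coord_eq_of_no_jump ha hcut fun k hk hjk => ?_).symm
  obtain ⟨ρ, hρ, hρk⟩ := (mem_flagType hint).1 hk
  rw [← hρk] at hjk ⊢
  exact (faceIndex_mono (S.cutFace_subset hint hσ.1 hi)).trans (hmin' ρ hρ hjk)

/-- Chamber faces are embedded isometrically. -/
theorem spread_exponent_sub (S : SupportingSystem P ι) (hint : (interior P).Nonempty)
    {F : PointedFlag P} {a b : ModelFlat n} (ha : a ∈ chamberFace F.flagType)
    (hb : b ∈ chamberFace F.flagType) :
    spread (S.exponent hint F a - S.exponent hint F b) = hexNorm (a - b) := by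
  have : Nonempty ι := ⟨S.top⟩
  rw [ModelFlat.hexNorm_eq_spread, map_sub]
  refine le_antisymm (spread_le fun i j => ?_) (spread_le fun i j => ?_)
  · exact sub_le_spread (ModelFlat.coord a - ModelFlat.coord b) _ _
  · obtain ⟨i', hi'⟩ := S.exists_exponent_eq_coord hint F i
    obtain ⟨j', hj'⟩ := S.exists_exponent_eq_coord hint F j
    have h := sub_le_spread (S.exponent hint F a - S.exponent hint F b) i' j'
    simpa only [Pi.sub_apply, hi' a ha, hi' b hb, hj' a ha, hj' b hb] using h

/-- The image of a chamber face in the tropical image is closed. -/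
theorem isClosed_image_exponent (S : SupportingSystem P ι) (hint : (interior P).Nonempty)
    (F : PointedFlag P) : IsClosed (S.exponent hint F '' chamberFace F.flagType) := by
  choose h hh using S.exists_exponent_eq_coord hint F
  have himage : S.exponent hint F '' chamberFace F.flagType =
      {τ | τ (h 0) = 0} ∩ ((⋂ k : Fin n, {τ | τ (h k.succ) ≤ τ (h k.castSucc)}) ∩
      ((⋂ k ∈ {k | k ∉ F.flagType}, {τ | τ (h k.castSucc) = τ (h k.succ)}) ∩
      ⋂ i, {τ | τ i = τ (h (faceIndex (S.cutFace hint F i)))})) := by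
    ext τ
    simp only [Set.mem_inter_iff, Set.mem_iInter, Set.mem_ofPred_eq]
    constructor
    · rintro ⟨a, ha, rfl⟩
      have hmem := ModelFlat.mem_chamberFace_iff.1 ha
      simp only [hh _ a ha]
      exact ⟨ModelFlat.coord_apply_zero a, hmem.1, hmem.2, fun i => rfl⟩
    · rintro ⟨h0, h1, h2, h3⟩
      have hcoord : ModelFlat.coord (Submodule.Quotient.mk (τ ∘ h) : ModelFlat n) = τ ∘ h :=
        ModelFlat.coord_mk_of_zero h0
      refine ⟨Submodule.Quotient.mk (τ ∘ h), ⟨τ ∘ h, rfl, h1, h2⟩, funext fun i => ?_⟩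
      rw [exponent, hcoord]
      exact (h3 i).symm
  rw [himage]
  refine (isClosed_eq (continuous_apply _) continuous_const).inter (IsClosed.inter ?_
    (IsClosed.inter ?_ ?_))
  · exact isClosed_iInter fun k => isClosed_le (continuous_apply _) (continuous_apply _)
  · exact isClosed_biInter fun k _ => isClosed_eq (continuous_apply _) (continuous_apply _)
  · exact isClosed_iInter fun i => isClosed_eq (continuous_apply _) (continuous_apply _)

end SupportingSystem

/-- A path that moves at most at unit speed within each of finitely many closed sets of parameters
covering the interval `[a, b]` has endpoints at distance at most `b - a`. -/
theorem edist_le_of_closed_cover {E κ : Type*} [PseudoEMetricSpace E] (γ : ℝ → E) (C : κ → Set ℝ)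
    (hC : ∀ k, IsClosed (C k))
    (hγ : ∀ k, ∀ s ∈ C k, ∀ t ∈ C k, s ≤ t → edist (γ s) (γ t) ≤ ENNReal.ofReal (t - s))
    (I : Finset κ) {a b : ℝ} (hab : a ≤ b) (hcover : Set.Icc a b ⊆ ⋃ k ∈ I, C k) :
    edist (γ a) (γ b) ≤ ENNReal.ofReal (b - a) := by
  classical
  induction I using Finset.strongInduction generalizing a with
  | H I ih =>
    obtain ⟨k, hk, hak⟩ := Set.mem_iUnion₂.1 (hcover (Set.left_mem_Icc.2 hab))
    have hcomp : IsCompact (C k ∩ Set.Icc a b) := isCompact_Icc.inter_left (hC k)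
    have hne : (C k ∩ Set.Icc a b).Nonempty := ⟨a, hak, Set.left_mem_Icc.2 hab⟩
    -- jump to the last parameter in the closed set containing `a`
    set t := sSup (C k ∩ Set.Icc a b) with ht
    have htmem : t ∈ C k ∩ Set.Icc a b := hcomp.sSup_mem hne
    have h1 := hγ k a hak t htmem.1 htmem.2.1
    rcases htmem.2.2.eq_or_lt with htb | htb
    · rwa [htb] at h1
    have hcover' : Set.Icc t b ⊆ ⋃ j ∈ I.erase k, C j := by
      rw [← closure_Ioc htb.ne]
      refine closure_minimal (fun s hs => ?_)
        ((I.erase k).finite_toSet.isClosed_biUnion fun j _ => hC j)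
      have hs' : s ∈ Set.Icc a b := ⟨htmem.2.1.trans hs.1.le, hs.2⟩
      obtain ⟨j, hj, hsj⟩ := Set.mem_iUnion₂.1 (hcover hs')
      refine Set.mem_iUnion₂.2 ⟨j, Finset.mem_erase.2 ⟨?_, hj⟩, hsj⟩
      rintro rfl
      exact absurd (le_csSup hcomp.bddAbove ⟨hsj, hs'⟩) (not_le.2 hs.1)
    have h2 := ih (I.erase k) (Finset.erase_ssubset hk) htb.le hcover'
    calc edist (γ a) (γ b) ≤ edist (γ a) (γ t) + edist (γ t) (γ b) := edist_triangle _ _ _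
      _ ≤ ENNReal.ofReal (t - a) + ENNReal.ofReal (b - t) := add_le_add h1 h2
      _ = ENNReal.ofReal (b - a) := by
        rw [← ENNReal.ofReal_add (by linarith [htmem.2.1]) (by linarith)]
        congr 1
        ring

/-- The tropical segment `s ↦ max (s + τ, τ')` between two families of exponents, normalized so that
an entry vanishing in both families stays equal to zero. -/
def tropicalSegment {ι : Type*} (τ τ' : ι → ℝ) (s : ℝ) (i : ι) : ℝ := max (s + τ i) (τ' i) - max s 0

theorem continuous_tropicalSegment {ι : Type*} (τ τ' : ι → ℝ) :
    Continuous (tropicalSegment τ τ') :=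
  continuous_pi fun i => by unfold tropicalSegment; fun_prop

theorem spread_tropicalSegment_sub_le {ι : Type*} [Nonempty ι] (τ τ' : ι → ℝ) {s t : ℝ}
    (hst : s ≤ t) : spread (tropicalSegment τ τ' s - tropicalSegment τ τ' t) ≤ t - s := by
  have h1 : ∀ i, max (s + τ i) (τ' i) ≤ max (t + τ i) (τ' i) := fun i =>
    max_le_max_right _ (by linarith)
  have h2 : ∀ i, max (t + τ i) (τ' i) ≤ max (s + τ i) (τ' i) + (t - s) := fun i =>
    max_le (by linarith [le_max_left (s + τ i) (τ' i)])
      (by linarith [le_max_right (s + τ i) (τ' i)])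
  refine spread_le fun i j => ?_
  simp only [Pi.sub_apply, tropicalSegment]
  linarith [h1 i, h2 j]

namespace SupportingSystem

variable {n : ℕ} {P : Set (Chart n)} {ι : Type*} [Fintype ι]

/-- The tropical image is tropically convex. -/
theorem tropicalSegment_mem {S : SupportingSystem P ι} {τ τ' : ι → ℝ} (hτ : τ ∈ S.tropicalSet)
    (hτ' : τ' ∈ S.tropicalSet) (s : ℝ) : tropicalSegment τ τ' s ∈ S.tropicalSet := by
  refine ⟨by simp [tropicalSegment, hτ.1, hτ'.1], fun c => ?_⟩
  obtain ⟨A, hA, h⟩ := hτ.2 (c + max s 0 - s)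
  obtain ⟨A', hA', h'⟩ := hτ'.2 (c + max s 0)
  refine ⟨A ∪ A', Set.union_subset hA hA', fun i => ?_⟩
  rw [Set.union_subset_iff, h, h', tropicalSegment, sub_lt_iff_lt_add, max_lt_iff, lt_sub_iff_add_lt']

/-- Two points of the same chamber face are joined by a chain with one link. -/
theorem edist_mk_le (S : SupportingSystem P ι) (hint : (interior P).Nonempty) {F : PointedFlag P}
    {a b : ModelFlat n} (ha : a ∈ chamberFace F.flagType) (hb : b ∈ chamberFace F.flagType)
    {x y : FlagRealization P} (hx : x = Quot.mk _ ⟨F, a, ha⟩) (hy : y = Quot.mk _ ⟨F, b, hb⟩) :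
    edist x y ≤ ENNReal.ofReal (spread (S.exponent hint F a - S.exponent hint F b)) := by
  subst hx hy
  refine iInf₂_le_of_le [(⟨F, a, ha⟩, ⟨F, b, hb⟩)] ⟨rfl, rfl⟩ ?_
  rw [S.spread_exponent_sub hint ha hb]
  simp [chainLength, chamberUnionEDist]

theorem ofReal_spread_le_edist (S : SupportingSystem P ι) (hint : (interior P).Nonempty)
    (x y : FlagRealization P) :
    ENNReal.ofReal (spread (S.realizationExponent hint x - S.realizationExponent hint y)) ≤
      edist x y := by
  have : Nonempty ι := ⟨S.top⟩
  refine le_iInf₂ fun l hl => ?_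
  induction l generalizing x with
  | nil =>
    obtain rfl : x = y := hl
    simp [chainLength, spread]
  | cons p l ih =>
    obtain ⟨⟨F, a, ha⟩, F', b, hb⟩ := p
    obtain ⟨rfl, hl⟩ := hl
    have hlen : chainLength chamberUnionEDist
        ((⟨F, a, ha⟩, ⟨F', b, hb⟩) :: l : List (ChamberUnion P × ChamberUnion P)) =
        chamberUnionEDist ⟨F, a, ha⟩ ⟨F', b, hb⟩ + chainLength chamberUnionEDist l := by
      simp [chainLength]
    rw [hlen]
    by_cases hF : F = F'
    · subst hF
      have hstep : chamberUnionEDist (⟨F, a, ha⟩ : ChamberUnion P) ⟨F, b, hb⟩ =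
          ENNReal.ofReal (spread (S.exponent hint F a - S.exponent hint F b)) := by
        rw [S.spread_exponent_sub hint ha hb]
        simp [chamberUnionEDist]
      rw [hstep]
      refine le_trans ?_ (add_le_add_right (ih (Quot.mk _ ⟨F, b, hb⟩) hl) _)
      rw [← ENNReal.ofReal_add (spread_nonneg _) (spread_nonneg _)]
      refine ENNReal.ofReal_le_ofReal (le_trans (le_of_eq ?_) (spread_add_le _ _))
      congr 1
      exact (sub_add_sub_cancel _ _ _).symm
    · simp [chamberUnionEDist, hF]

/-- The quotient metric of the flag realization is induced by the spread seminorm, because tropical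
segments are geodesics that stay in the tropical image and cross finitely many chamber faces. -/
theorem edist_eq_ofReal_spread (S : SupportingSystem P ι) (hint : (interior P).Nonempty)
    (x y : FlagRealization P) :
    edist x y =
      ENNReal.ofReal (spread (S.realizationExponent hint x - S.realizationExponent hint y)) := by
  classical
  have : Nonempty ι := ⟨S.top⟩
  have := S.finite_pointedFlag
  have := Fintype.ofFinite (PointedFlag P)
  refine le_antisymm ?_ (S.ofReal_spread_le_edist hint x y)
  set τ := S.realizationExponent hint x with hτ
  set τ' := S.realizationExponent hint y with hτ'
  have hτT : τ ∈ S.tropicalSet := S.range_realizationExponent hint ▸ Set.mem_range_self x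
  have hτT' : τ' ∈ S.tropicalSet := S.range_realizationExponent hint ▸ Set.mem_range_self y
  have hlift : ∀ s, ∃ z, S.realizationExponent hint z = tropicalSegment τ τ' s := fun s => by
    have h := tropicalSegment_mem hτT hτT' s
    rwa [← S.range_realizationExponent hint] at h
  choose γ hγ using hlift
  -- the segment runs from `τ'` at the smallest entry of `τ' - τ` to `τ` at the largest one
  obtain ⟨i, -, hi⟩ := Finset.exists_min_image Finset.univ (τ' - τ) Finset.univ_nonempty
  obtain ⟨j, -, hj⟩ := Finset.exists_max_image Finset.univ (τ' - τ) Finset.univ_nonempty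
  have hi' : ∀ k, τ' i - τ i ≤ τ' k - τ k := fun k => hi k (Finset.mem_univ k)
  have hj' : ∀ k, τ' k - τ k ≤ τ' j - τ j := fun k => hj k (Finset.mem_univ k)
  have htop : τ S.top = 0 := hτT.1
  have htop' : τ' S.top = 0 := hτT'.1
  have hstart : γ (τ' i - τ i) = y := by
    refine S.realizationExponent_injective hint ?_
    rw [hγ]
    funext k
    have h0 := hi' S.top
    rw [htop, htop', sub_zero] at h0
    rw [tropicalSegment, max_eq_right h0, max_eq_right (by linarith [hi' k]), sub_zero]
  have hend : γ (τ' j - τ j) = x := by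
    refine S.realizationExponent_injective hint ?_
    rw [hγ]
    funext k
    have h0 := hj' S.top
    rw [htop, htop', sub_zero] at h0
    rw [tropicalSegment, max_eq_left h0, max_eq_left (by linarith [hj' k])]
    ring
  have key := edist_le_of_closed_cover γ
    (fun F => tropicalSegment τ τ' ⁻¹' (S.exponent hint F '' chamberFace F.flagType))
    (fun F => (S.isClosed_image_exponent hint F).preimage (continuous_tropicalSegment τ τ'))
    (fun F s hs t ht hst => by
      obtain ⟨a, ha, has⟩ := hs
      obtain ⟨b, hb, hbt⟩ := ht
      have hs' : γ s = Quot.mk _ ⟨F, a, ha⟩ :=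
        S.realizationExponent_injective hint ((hγ s).trans has.symm)
      have ht' : γ t = Quot.mk _ ⟨F, b, hb⟩ :=
        S.realizationExponent_injective hint ((hγ t).trans hbt.symm)
      refine (S.edist_mk_le hint ha hb hs' ht').trans (ENNReal.ofReal_le_ofReal ?_)
      rw [has, hbt]
      exact spread_tropicalSegment_sub_le τ τ' hst)
    Finset.univ (hi' j) (fun s _ => by
      obtain ⟨⟨F, a, ha⟩, h⟩ := Quot.exists_rep (γ s)
      refine Set.mem_iUnion₂.2 ⟨F, Finset.mem_univ F, a, ha, ?_⟩
      rw [← hγ s, ← h]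
      rfl)
  rw [hstart, hend, edist_comm] at key
  refine key.trans (ENNReal.ofReal_le_ofReal ?_)
  have h := sub_le_spread (τ - τ') i j
  simp only [Pi.sub_apply] at h
  linarith

theorem realizationExponent_conePoint (S : SupportingSystem P ι) (hint : (interior P).Nonempty) :
    S.realizationExponent hint (FlagRealization.conePoint (hint.mono interior_subset)) = 0 :=
  funext fun i => congrFun (map_zero ModelFlat.coord) (faceIndex (S.cutFace hint _ i))

theorem eq_of_ofReal_spread_sub_eq_zero {S : SupportingSystem P ι} {σ τ : ι → ℝ}
    (hσ : σ ∈ S.tropicalSet) (hτ : τ ∈ S.tropicalSet)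
    (h : ENNReal.ofReal (spread (σ - τ)) = 0) : σ = τ := by
  rw [ENNReal.ofReal_eq_zero] at h
  funext i
  have h1 := (abs_sub_le_spread (σ - τ) i S.top).trans h
  simp only [Pi.sub_apply, hσ.1, hτ.1, sub_zero] at h1
  exact sub_eq_zero.1 (abs_eq_zero.1 (le_antisymm h1 (abs_nonneg _)))

end SupportingSystem

end

theorem theoremE {n : ℕ} (P : Set (Chart n)) (hP : IsPolytope P) (hint : (interior P).Nonempty)
    (ω : Ultrafilter ℕ) (hω : ∀ k : ℕ, ω ≠ pure k)
    (lam : ℕ → ℝ) (hlam : IsScalingSequence lam) (x₀ : HilbertGeometry (interior P)) :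
    ∃ f : AsymptoticCone ω lam (fun _ => x₀) ≃ᵢ FlagRealization P,
      f (AsymptoticCone.base ω lam fun _ => x₀) =
        FlagRealization.conePoint (hint.mono interior_subset) := by
  obtain ⟨E, ⟨S⟩⟩ := hP.exists_supportingSystem
  have hlim := Ultrafilter.tendsto_atTop_of_ne_pure hω hlam
  choose Ψ hΨ using fun x : OmegaBounded ω lam (fun _ => x₀) => S.exists_isLogLimit hP hlam x.bounded
  have hΨT : ∀ x, Ψ x ∈ S.tropicalSet := fun x => (hΨ x).mem_tropicalSet hP hlim
  have hdist : ∀ x y, edist x y = ENNReal.ofReal (spread (Ψ x - Ψ y)) := fun x y =>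
    (hΨ x).ultraEDist_eq hP hlim (hΨ y)
  have hlift : ∀ x, ∃ z, S.realizationExponent hint z = Ψ x := fun x => by
    have h := hΨT x
    rwa [← S.range_realizationExponent hint] at h
  choose g hg using hlift
  have hgdist : ∀ x y, edist (g x) (g y) = edist x y := fun x y => by
    rw [S.edist_eq_ofReal_spread hint, hg, hg, hdist]
  have hginsep : ∀ x y, Inseparable x y → g x = g y := fun x y h => by
    refine S.realizationExponent_injective hint ?_
    rw [hg, hg]
    refine SupportingSystem.eq_of_ofReal_spread_sub_eq_zero (hΨT x) (hΨT y) ?_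
    rw [← hdist]
    exact EMetric.inseparable_iff.1 h
  let f : AsymptoticCone ω lam (fun _ => x₀) → FlagRealization P := SeparationQuotient.lift g hginsep
  have hf : Isometry f := by
    intro a b
    obtain ⟨x, rfl⟩ := SeparationQuotient.surjective_mk a
    obtain ⟨y, rfl⟩ := SeparationQuotient.surjective_mk b
    rw [SeparationQuotient.edist_mk]
    exact hgdist x y
  have hsurj : Function.Surjective f := by
    intro z
    have hz : S.realizationExponent hint z ∈ S.tropicalSet :=
      S.range_realizationExponent hint ▸ Set.mem_range_self z
    obtain ⟨x, hx⟩ := S.exists_isLogLimit_eq hP hlim hlam.1 hz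
    have hbdd : ultraEDist ω lam (fun _ => x₀) x < ⊤ := by
      rw [(S.isLogLimit_const hlim x₀).ultraEDist_eq hP hlim hx]
      exact ENNReal.ofReal_lt_top
    refine ⟨SeparationQuotient.mk ⟨x, hbdd⟩, S.realizationExponent_injective hint ?_⟩
    change S.realizationExponent hint (g ⟨x, hbdd⟩) = _
    rw [hg]
    exact funext fun i => tendsto_nhds_unique (hΨ ⟨x, hbdd⟩ i) (hx i)
  refine ⟨⟨Equiv.ofBijective f ⟨hf.injective, hsurj⟩, hf⟩, ?_⟩
  refine S.realizationExponent_injective hint ?_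
  rw [S.realizationExponent_conePoint hint]
  change S.realizationExponent hint (g _) = 0
  rw [hg]
  exact funext fun i => tendsto_nhds_unique (hΨ _ i) (S.isLogLimit_const hlim x₀ i)
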